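/- Let $N\ge 2$. For $q,p\ge 1$ put $B=\{y\in\mathbb R^q:\max_{i,j}|y_i-y_j|\le 1\}$ and, for $g:\mathbb R^q\to\mathbb R^p$, $\|g\|_B=\sup_{y\in B}\max_i|g_i(y)|$, $\|dg\|_B=\max_{i,j}\|\partial_j g_i\|_B$, $\|d^2g\|_B=\max_{i,j,k}\|\partial_k\partial_j g_i\|_B$ (these may be $+\infty$). Write $\mathbb 1=(1,\dots,1)$, and regard a function $F:\mathbb R^N\times\mathbb R\to\mathbb R$ also as a function on $\mathbb R^{N+1}$; $\partial_{N+1}F$ is its derivative in the last (scalar) argument. Let $\|\cdot\|$ be the maximum norm on $\mathbb R^N$. Assume that $F$ satisfies $(H)$: $F$ is $C^2$, $\max\{\|F\|_B,\|dF\|_B,\|d^2F\|_B\}<\infty$, $F(y+\mathbb 1,z+1)=F(y,z)$ for all $(y,z)\in\mathbb R^N\times\mathbb R$, and $\min_{s\in[0,1]}F(s\mathbb 1,s)>0$; $(H_*)$: $\displaystyle\int_0^1\frac{\partial_{N+1}F(s\mathbb 1,s)}{F(s\mathbb 1,s)}\,ds<0$. For a $C^1$ map $H=(H_1,\dots,H_N):\mathbb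 R^N\to\mathbb R^N$ and $t_0\in\mathbb R$ consider the system $$(P)\qquad \dot x_i=F(X,x_i)+H_i(X),\quad i=1,\dots,N,\quad t\ge t_0,\quad X=(x_1,\dots,x_N),$$ and let $\Phi^t(X)$ denote its solution with $\Phi^{t_0}(X)=X$. Then there exists $D_*>0$ such that for every $D\in(0,D_*]$ there exist $r>0$ and a $C^1$, $1$-periodic function $\Delta_r:\mathbb R\to(0,D]$ such that the open set $$C_r=\{X\in\mathbb R^N:\ \exists\,\nu\in\mathbb R,\ \max_i|x_i-\nu|<\Delta_r(\nu)\}$$ has the following properties. (0) (Synchronization region.) For every $C^1$ map $H$ with $\|H\|_B<r$ and every $t_0$: for every $X\in C_r$ the solution $\Phi^t(X)$ exists for all $t\ge t_0$ and stays in $C_r$, $\min_i\inf_{t\ge t_0}\frac{d}{dt}\Phi^t_i(X)>0$, and $|\Phi^t_i(X)-\Phi^t_j(X)|<2D$ for all $i,j$ and all $t\ge t_0$. Moreover, for every $C^1$ map $H$ with $\max\{\|H\|_B,\|dH\|_B\}<r$ and every $t_0$: (1) (Stability.) There exists $M>0$ such that for every $X\in C_r$ there is $\delta>0$ such that for every $Y\in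 C_r$ with $Y\ne X$ and $\|X-Y\|<\delta$, $$\|\Phi^t(X)-\Phi^t(Y)\|<M\,\|X-Y\|\qquad\text{for all }t\ge t_0 .$$ (2) (Exponentially stable submanifolds.) For every $X\in C_r$ there is an embedded $C^1$ submanifold $\mathcal W_X$ of $\mathbb R^N$ of dimension $N-1$ with $X\in\mathcal W_X\subset C_r$, and there are $\beta>0$ and $K>0$, independent of $X$, such that for all $X\in C_r$ and all $Y\in\mathcal W_X$ with $Y\neq X$, $$\|\Phi^t(X)-\Phi^t(Y)\|<K\,e^{-\beta(t-t_0)}\,\|X-Y\|\qquad\text{for all }t\ge t_0 .$$ -/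

import Mathlib

open Set
open scoped ENNReal

noncomputable section

namespace MeanField

/-- The set `B` of all `y ∈ ℝ^q` whose coordinates differ pairwise by at most `1`. -/
def band (q : ℕ) : Set (Fin q → ℝ) := {y | ∀ i j, |y i - y j| ≤ 1}

/-- `‖g‖_B`, the supremum over `y ∈ B` of `max_i |g_i(y)|`, as an extended nonnegative number
(it is `∞` exactly when `g` is unbounded on `B`). -/
def normB {q p : ℕ} (g : (Fin q → ℝ) → Fin p → ℝ) : ℝ≥0∞ :=
  ⨆ y ∈ band q, ⨆ i : Fin p, ‖g y i‖ₑ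

/-- The partial derivative `∂_j g`. -/
def pd {q : ℕ} (j : Fin q) (g : (Fin q → ℝ) → ℝ) (y : Fin q → ℝ) : ℝ :=
  fderiv ℝ g y (Pi.single j 1)

/-- `‖dg‖_B`, the maximum over `i, j` of `‖∂_j g_i‖_B`. -/
def normB1 {q p : ℕ} (g : (Fin q → ℝ) → Fin p → ℝ) : ℝ≥0∞ :=
  ⨆ y ∈ band q, ⨆ (i : Fin p) (j : Fin q), ‖pd j (fun z => g z i) y‖ₑ

/-- `‖d²g‖_B`, the maximum over `i, j, k` of `‖∂_k ∂_j g_i‖_B`. -/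
def normB2 {q p : ℕ} (g : (Fin q → ℝ) → Fin p → ℝ) : ℝ≥0∞ :=
  ⨆ y ∈ band q, ⨆ (i : Fin p) (j : Fin q) (k : Fin q), ‖pd k (pd j (fun z => g z i)) y‖ₑ

/-- `F : ℝ^N × ℝ → ℝ` seen as a map `ℝ^(N+1) → ℝ^1`; the last coordinate is the scalar
argument of `F`. -/
def joint {N : ℕ} (F : (Fin N → ℝ) → ℝ → ℝ) : (Fin (N + 1) → ℝ) → Fin 1 → ℝ :=
  fun w _ => F (fun i => w i.castSucc) (w (Fin.last N))

/-- The hypothesis `(H)`. -/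
structure HypH {N : ℕ} (F : (Fin N → ℝ) → ℝ → ℝ) : Prop where
  contDiff : ContDiff ℝ 2 (fun p : (Fin N → ℝ) × ℝ => F p.1 p.2)
  bounded : max (normB (joint F)) (max (normB1 (joint F)) (normB2 (joint F))) < ∞
  periodic : ∀ (y : Fin N → ℝ) (z : ℝ), F (fun i => y i + 1) (z + 1) = F y z
  pos : ∀ s ∈ Icc (0 : ℝ) 1, 0 < F (fun _ => s) s

/-- The synchronization hypothesis `(H_*)`. -/
def HypHStar {N : ℕ} (F : (Fin N → ℝ) → ℝ → ℝ) : Prop :=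
  ∫ s in (0 : ℝ)..1, deriv (fun z => F (fun _ => s) z) s / F (fun _ => s) s < 0

/-- The right-hand side of the perturbed system `ẋ_i = F(X, x_i) + H_i(X)`. -/
def field {N : ℕ} (F : (Fin N → ℝ) → ℝ → ℝ) (H : (Fin N → ℝ) → Fin N → ℝ) :
    (Fin N → ℝ) → Fin N → ℝ :=
  fun X i => F X (X i) + H X i

/-- `Φ` is the flow, with initial time `t₀`, of `Ẋ = V(X)` for all initial conditions in `C` and
all times `t ≥ t₀` (for a `C¹` field `V` it is determined by this). -/
def IsFlowOn {N : ℕ} (V : (Fin N → ℝ) → Fin N → ℝ) (t₀ : ℝ) (C : Set (Fin N → ℝ))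
    (Φ : ℝ → (Fin N → ℝ) → Fin N → ℝ) : Prop :=
  ∀ X ∈ C, Φ t₀ X = X ∧
    ∀ t ≥ t₀, HasDerivWithinAt (fun s => Φ s X) (V (Φ t X)) (Ici t₀) t

/-- The tube `{X : ∃ ν, max_i |x_i - ν| < Δ(ν)}` around the diagonal. -/
def tube (N : ℕ) (Δ : ℝ → ℝ) : Set (Fin N → ℝ) := {X | ∃ ν : ℝ, ∀ i, |X i - ν| < Δ ν}

/-- `Δ : ℝ → (0, D]` is `C¹` and `1`-periodic. -/
structure IsTubeRadius (D : ℝ) (Δ : ℝ → ℝ) : Prop where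
  contDiff : ContDiff ℝ 1 Δ
  periodic : ∀ ν, Δ (ν + 1) = Δ ν
  mem : ∀ ν, Δ ν ∈ Ioc 0 D

/-- `W` is an (embedded) `C¹` submanifold of `ℝ^N` of dimension `k`: around each of its points
there is a `C¹` diffeomorphism between open subsets of `ℝ^N` that straightens `W` to
`ℝ^k × {0}`. -/
def IsC1Submanifold {N : ℕ} (k : ℕ) (W : Set (Fin N → ℝ)) : Prop :=
  ∀ p ∈ W, ∃ φ : OpenPartialHomeomorph (Fin N → ℝ) (Fin N → ℝ),
    p ∈ φ.source ∧ ContDiffOn ℝ 1 φ φ.source ∧ ContDiffOn ℝ 1 φ.symm φ.target ∧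
      ∀ x ∈ φ.source, (x ∈ W ↔ ∀ i : Fin N, k ≤ (i : ℕ) → φ x i = 0)

/-- `C` is a synchronization region for the field `V`, with dispersion parameter `D`:
the flow exists on `C` for all times, leaves `C` positively invariant, has all velocities bounded
below by a positive constant along each orbit, and keeps all phase differences below `2D`. -/
def IsSynchronized {N : ℕ} (V : (Fin N → ℝ) → Fin N → ℝ) (t₀ D : ℝ)
    (C : Set (Fin N → ℝ)) : Prop :=
  (∃ Φ, IsFlowOn V t₀ C Φ) ∧
  ∀ Φ, IsFlowOn V t₀ C Φ → ∀ X ∈ C,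
    (∀ t ≥ t₀, Φ t X ∈ C) ∧
    (∃ c > 0, ∀ i, ∀ t ≥ t₀, c ≤ derivWithin (fun s => Φ s X i) (Ici t₀) t) ∧
    ∀ i j, ∀ t ≥ t₀, |Φ t X i - Φ t X j| < 2 * D

end MeanField

end

/-! Near the diagonal all coordinates follow the scalar equation `ν' = F(ν𝟙, ν)` up to small errors.
The difference `u` of two coordinates then satisfies `du/dν ≈ g(ν) u` with `g = ∂_{N+1}F / F`, and
(H_*) says that `g` has mean `-γ < 0`.

Synchronization. The weight `w = exp(∫ g + γν)` is periodic (`exists_periodic_weight`). A tube whose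
radius is proportional to `w` grows at rate `g + γ`, faster than the differences of coordinates, so
the field points strictly inwards on its boundary, with a margin proportional to `γ` that absorbs
`H` (`inward_on_boundary`). The centre `ν` of the tube is carried along as an extra unknown, and
invariance becomes a barrier argument (`exists_solution_mem_tube`).

Stability. One coordinate `x_l` serves as independent variable. For two points with equal phase, a
change in the mean-field argument of `F` shifts all components of the field by nearly the same
amount. After division by the `l`-th component this shift cancels to leading order, and differences
contract at rate `g` up to an error of rate at most `γ/2` (`norm_rescaled_sub_le`). Hence orbits
compared at equal phase approach each other exponentially (`norm_P_sub_P_le`), and the lag between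
the times at which they reach a given phase converges exponentially (`abs_T_increment_le`). Bounded
lags give uniform stability in the original time; a lag tending to zero gives exponential
convergence.

Hypersurfaces. The limiting lag `θ` relative to the orbit of `X` is a limit of `C¹` functions with
geometrically small increments, hence `C¹`. Its differential at `X` is nonzero, because moving along
the orbit for a time `τ` changes the lag by `-τ` (`exists_asymptotic_lag`). The submanifold through
`X` is the zero set of `θ` near `X`. -/

namespace MeanField

open Filter Metric
open scoped Topology NNReal

/-! ### Ordinary differential equations: existence, uniqueness, barriers. -/

section ODE

variable {E : Type*} [NormedAddCommGroup E] [NormedSpace ℝ E]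

/-- In a finite-dimensional space every ball is fixed by some bounded Lipschitz map of linear
growth. -/
lemma exists_bounded_lipschitz_retraction [FiniteDimensional ℝ E] :
    ∃ C : ℝ, 0 ≤ C ∧ ∀ R : ℝ, ∃ (ρ : E → E) (K : ℝ≥0) (R' : ℝ), LipschitzWith K ρ ∧
      (∀ x, ‖ρ x‖ ≤ R') ∧ (∀ x, ‖x‖ ≤ R → ρ x = x) ∧ ∀ x, ‖ρ x‖ ≤ C * ‖x‖ := by
  let e : E ≃L[ℝ] (Fin (Module.finrank ℝ E) → ℝ) :=
    ContinuousLinearEquiv.ofFinrankEq (by simp)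
  let e₁ : E →L[ℝ] (Fin (Module.finrank ℝ E) → ℝ) := e
  let e₂ : (Fin (Module.finrank ℝ E) → ℝ) →L[ℝ] E := e.symm
  refine ⟨‖e₂‖ * ‖e₁‖, by positivity, fun R => ?_⟩
  obtain ⟨r, hr0, hr⟩ : ∃ r : ℝ, 0 ≤ r ∧ ∀ x, ‖x‖ ≤ R → ‖e x‖ ≤ r := by
    refine ⟨‖e₁‖ * |R|, by positivity, fun x hx => ?_⟩
    exact (e₁.le_opNorm x).trans
      (mul_le_mul_of_nonneg_left (hx.trans (le_abs_self R)) (norm_nonneg _))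
  -- Coordinatewise truncation is nonexpansive for the sup norm, whence the transport to `Fin n →
  -- ℝ`. It also fixes `0`, which yields a growth constant independent of `R`.
  let c : (Fin (Module.finrank ℝ E) → ℝ) → Fin (Module.finrank ℝ E) → ℝ :=
    fun y i => max (-r) (min r (y i))
  have hc1 : LipschitzWith 1 c := by
    refine LipschitzWith.of_dist_le_mul fun x y => ?_
    rw [NNReal.coe_one, one_mul, dist_pi_le_iff dist_nonneg]
    intro i
    refine le_trans ?_ (dist_le_pi_dist x y i)
    simp only [c, Real.dist_eq]
    refine ((abs_max_sub_max_le_max _ _ _ _).trans ?_)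
    simpa using abs_min_sub_min_le_max r (x i) r (y i)
  have hcb : ∀ y, ‖c y‖ ≤ r := by
    intro y
    rw [pi_norm_le_iff_of_nonneg hr0]
    intro i
    rw [Real.norm_eq_abs, abs_le]
    exact ⟨le_max_left _ _, max_le (by linarith) (min_le_left _ _)⟩
  have hcle : ∀ y, ‖c y‖ ≤ ‖y‖ := by
    intro y
    have h0 : c 0 = 0 := by
      ext i; simp [c, hr0]
    simpa [h0] using hc1.dist_le_mul y 0
  have hcid : ∀ y, ‖y‖ ≤ r → c y = y := by
    intro y hy
    ext i
    have := (norm_le_pi_norm y i).trans hy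
    rw [Real.norm_eq_abs, abs_le] at this
    simp [c, this.1, this.2]
  refine ⟨fun x => e.symm (c (e x)), _, ‖e₂‖ * r, (e.symm.lipschitz.comp hc1).comp e.lipschitz,
    fun x => ?_, fun x hx => ?_, fun x => ?_⟩
  · exact (e₂.le_opNorm _).trans
      (mul_le_mul_of_nonneg_left (hcb _) (norm_nonneg _))
  · simp [hcid _ (hr x hx)]
  · refine (e₂.le_opNorm _).trans ?_
    rw [mul_assoc]
    exact mul_le_mul_of_nonneg_left ((hcle _).trans (e₁.le_opNorm x)) (norm_nonneg _)

/-- A bounded, globally Lipschitz time-dependent field has solutions on every compact interval. -/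
lemma exists_solution_of_bounded_lipschitz [CompleteSpace E] {f : ℝ → E → E} {K L : ℝ≥0} {T : ℝ}
    (hT : 0 ≤ T) (hlip : ∀ t ∈ Icc 0 T, LipschitzWith K (f t))
    (hc : ∀ x, ContinuousOn (fun t => f t x) (Icc 0 T))
    (hb : ∀ t ∈ Icc 0 T, ∀ x, ‖f t x‖ ≤ L) (x₀ : E) :
    ∃ z : ℝ → E, z 0 = x₀ ∧
      ∀ t ∈ Icc 0 T, HasDerivWithinAt z (f t (z t)) (Icc 0 T) t := by
  have h : IsPicardLindelof f (⟨0, le_rfl, hT⟩ : Icc (0 : ℝ) T) x₀ (L * T.toNNReal) 0 L K :=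
    { lipschitzOnWith := fun t ht => (hlip t ht).lipschitzOnWith
      continuousOn := fun x _ => hc x
      norm_le := fun t ht x _ => hb t ht x
      mul_max_le := by simp [hT] }
  exact h.exists_eq_forall_mem_Icc_hasDerivWithinAt₀

lemma hasDerivWithinAt_Ici_of_Icc {z : ℝ → E} {z' : E} {a b t : ℝ} (ht : t ∈ Ico a b)
    (h : HasDerivWithinAt z z' (Icc a b) t) : HasDerivWithinAt z z' (Ici t) t :=
  h.mono_of_mem_nhdsWithin
    (mem_of_superset (Icc_mem_nhdsGE ht.2) (Icc_subset_Icc_left ht.1))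

lemma continuousOn_of_hasDerivWithinAt {z z' : ℝ → E} {s : Set ℝ}
    (h : ∀ t ∈ s, HasDerivWithinAt z (z' t) s t) : ContinuousOn z s :=
  fun t ht => (h t ht).continuousWithinAt

/-- Grönwall's inequality on `[0, T]`. -/
lemma norm_le_gronwall_Icc {z z' : ℝ → E} {δ K ε a b : ℝ}
    (hz : ∀ t ∈ Icc a b, HasDerivWithinAt z (z' t) (Icc a b) t) (h0 : ‖z a‖ ≤ δ)
    (hb : ∀ t ∈ Ico a b, ‖z' t‖ ≤ K * ‖z t‖ + ε) :
    ∀ t ∈ Icc a b, ‖z t‖ ≤ gronwallBound δ K ε (t - a) :=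
  norm_le_gronwallBound_of_norm_deriv_right_le (continuousOn_of_hasDerivWithinAt hz)
    (fun t ht => hasDerivWithinAt_Ici_of_Icc ht (hz t (Ico_subset_Icc_self ht))) h0 hb

/-- A linear equation with continuous coefficients has a resolvent on `[0, T]`. -/
lemma exists_resolvent [FiniteDimensional ℝ E] {A : ℝ → E →L[ℝ] E} {T : ℝ} (hT : 0 ≤ T)
    (hA : ContinuousOn A (Icc 0 T)) :
    ∃ M : ℝ → E →L[ℝ] E, M 0 = ContinuousLinearMap.id ℝ E ∧
      ∀ t ∈ Icc 0 T, HasDerivWithinAt M (A t ∘L M t) (Icc 0 T) t := by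
  obtain ⟨a, ha⟩ := isCompact_Icc.exists_bound_of_continuousOn hA
  have ha0 : 0 ≤ a := (norm_nonneg _).trans (ha 0 ⟨le_rfl, hT⟩)
  let I : E →L[ℝ] E := ContinuousLinearMap.id ℝ E
  obtain ⟨C, hC0, hC⟩ := exists_bounded_lipschitz_retraction (E := E →L[ℝ] E)
  -- This Grönwall bound uses only the growth constant `C`, so it can be fixed before the truncation
  -- `ρ`. The solution of the truncated equation stays below `R`, where `ρ` is the identity.
  let R := gronwallBound ‖I‖ (a * C) 0 T
  obtain ⟨ρ, K, R', hK, hR', hid, hlin⟩ := hC R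
  have hR'0 : 0 ≤ R' := (norm_nonneg _).trans (hR' 0)
  obtain ⟨M, hM0, hM⟩ := exists_solution_of_bounded_lipschitz (f := fun t M => A t ∘L ρ M)
    (K := a.toNNReal * K) (L := (a * R').toNNReal) hT
    (fun t ht => by
      refine LipschitzWith.of_dist_le_mul fun x y => ?_
      rw [dist_eq_norm, ← ContinuousLinearMap.comp_sub]
      refine (ContinuousLinearMap.opNorm_comp_le _ _).trans ?_
      rw [NNReal.coe_mul, Real.coe_toNNReal _ ha0, mul_assoc, ← dist_eq_norm]
      exact mul_le_mul (ha t ht) (hK.dist_le_mul x y) dist_nonneg ha0)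
    (fun x => hA.clm_comp continuousOn_const)
    (fun t ht x => by
      rw [Real.coe_toNNReal _ (by positivity)]
      exact (ContinuousLinearMap.opNorm_comp_le _ _).trans
        (mul_le_mul (ha t ht) (hR' x) (norm_nonneg _) ha0)) I
  refine ⟨M, hM0, fun t ht => ?_⟩
  have hbound : ‖M t‖ ≤ R := by
    refine (norm_le_gronwall_Icc hM (by rw [hM0]) (K := a * C) (ε := 0) (fun s hs => ?_)
      t ht).trans (gronwallBound_mono (norm_nonneg _) le_rfl (by positivity) (by linarith [ht.2]))
    refine (ContinuousLinearMap.opNorm_comp_le _ _).trans ?_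
    rw [add_zero, mul_assoc]
    exact mul_le_mul (ha s (Ico_subset_Icc_self hs)) (hlin _) (norm_nonneg _) ha0
  simpa [hid _ hbound] using hM t ht

lemma exists_lipschitzOnWith_closedBall [FiniteDimensional ℝ E] {F : Type*} [NormedAddCommGroup F]
    [NormedSpace ℝ F] {W : E → F} (hW : ContDiff ℝ 1 W) (R : ℝ) :
    ∃ K, LipschitzOnWith K W (closedBall 0 R) :=
  LocallyLipschitzOn.exists_lipschitzOnWith_of_compact (isCompact_closedBall 0 R)
    hW.locallyLipschitz.locallyLipschitzOn

/-- Uniqueness of solutions of `ż = κ(t) W(z)` for a `C¹` field `W`. -/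
lemma solution_unique [FiniteDimensional ℝ E] {W : E → E} (hW : ContDiff ℝ 1 W) {κ : ℝ → ℝ}
    {a b : ℝ} (hκ : ContinuousOn κ (Icc a b)) {y z : ℝ → E}
    (hy : ∀ t ∈ Icc a b, HasDerivWithinAt y (κ t • W (y t)) (Icc a b) t)
    (hz : ∀ t ∈ Icc a b, HasDerivWithinAt z (κ t • W (z t)) (Icc a b) t)
    (h0 : y a = z a) : EqOn y z (Icc a b) := by
  have hyc := continuousOn_of_hasDerivWithinAt hy
  have hzc := continuousOn_of_hasDerivWithinAt hz
  obtain ⟨R₁, hR₁⟩ := isCompact_Icc.exists_bound_of_continuousOn hyc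
  obtain ⟨R₂, hR₂⟩ := isCompact_Icc.exists_bound_of_continuousOn hzc
  obtain ⟨B, hB⟩ := isCompact_Icc.exists_bound_of_continuousOn hκ
  obtain ⟨K, hK⟩ := exists_lipschitzOnWith_closedBall hW (max R₁ R₂)
  refine ODE_solution_unique_of_mem_Icc_right (v := fun t x => κ t • W x)
    (s := fun _ => closedBall 0 (max R₁ R₂)) (K := B.toNNReal * K) (fun t ht => ?_) hyc
    (fun t ht => hasDerivWithinAt_Ici_of_Icc ht (hy t (Ico_subset_Icc_self ht)))
    (fun t ht => ?_) hzc
    (fun t ht => hasDerivWithinAt_Ici_of_Icc ht (hz t (Ico_subset_Icc_self ht)))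
    (fun t ht => ?_) h0
  · have hB' := hB t (Ico_subset_Icc_self ht)
    refine LipschitzOnWith.of_dist_le_mul fun x hx y hy => ?_
    rw [dist_eq_norm, ← smul_sub, norm_smul, NNReal.coe_mul,
      Real.coe_toNNReal _ ((norm_nonneg _).trans hB'), mul_assoc, ← dist_eq_norm]
    exact mul_le_mul hB' (hK.dist_le_mul x hx y hy) dist_nonneg ((norm_nonneg _).trans hB')
  · simpa using Or.inl (hR₁ t (Ico_subset_Icc_self ht))
  · simpa using Or.inr (hR₂ t (Ico_subset_Icc_self ht))

lemma solution_unique_autonomous [FiniteDimensional ℝ E] {W : E → E} (hW : ContDiff ℝ 1 W)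
    {a b : ℝ} {y z : ℝ → E} (hy : ∀ t ∈ Icc a b, HasDerivWithinAt y (W (y t)) (Icc a b) t)
    (hz : ∀ t ∈ Icc a b, HasDerivWithinAt z (W (z t)) (Icc a b) t)
    (h0 : y a = z a) : EqOn y z (Icc a b) :=
  solution_unique hW (κ := fun _ => 1) continuousOn_const (by simpa using hy) (by simpa using hz) h0

/-- Solutions on all compact intervals `[0, T]` glue to a solution on `[0, ∞)`. -/
lemma exists_global_solution [FiniteDimensional ℝ E] {W : E → E} (hW : ContDiff ℝ 1 W)
    {S : Set E} {z₀ : E}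
    (h : ∀ T > 0, ∃ z : ℝ → E, z 0 = z₀ ∧
      (∀ t ∈ Icc 0 T, HasDerivWithinAt z (W (z t)) (Icc 0 T) t) ∧ ∀ t ∈ Icc 0 T, z t ∈ S) :
    ∃ z : ℝ → E, z 0 = z₀ ∧ (∀ t ≥ 0, HasDerivWithinAt z (W (z t)) (Ici 0) t) ∧
      ∀ t ≥ 0, z t ∈ S := by
  choose! z h0 hz hS using h
  have key : ∀ T > 0, ∀ t ∈ Icc 0 T, z (t + 1) t = z T t := by
    intro T hT t ht
    have hm : ∀ T' ≥ t, ∀ s ∈ Icc 0 t, T' > 0 →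
        HasDerivWithinAt (z T') (W (z T' s)) (Icc 0 t) s := fun T' hT' s hs hT'0 =>
      (hz T' hT'0 s ⟨hs.1, hs.2.trans hT'⟩).mono (Icc_subset_Icc_right hT')
    exact solution_unique_autonomous hW
      (fun s hs => hm (t + 1) (by linarith) s hs (by linarith [ht.1]))
      (fun s hs => hm T ht.2 s hs hT) (by rw [h0 _ hT, h0 _ (by linarith [ht.1])])
      ⟨ht.1, le_rfl⟩
  -- The horizon `t + 1` is positive even at `t = 0`. For the derivative at `t` the fixed horizon `t
  -- + 2` is used, so that a neighbourhood of `t` in `[0, ∞)` is covered.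
  refine ⟨fun t => z (t + 1) t, by simp [h0], fun t ht => ?_, fun t ht => ?_⟩
  · have h2 : 0 < t + 2 := by linarith
    have ht2 : t ∈ Icc 0 (t + 2) := ⟨ht, by linarith⟩
    have h3 : HasDerivWithinAt (fun s => z (s + 1) s) (W (z (t + 2) t)) (Icc 0 (t + 2)) t :=
      (hz (t + 2) h2 t ht2).congr (fun s hs => key _ h2 s hs) (key _ h2 t ht2)
    have hmem : Icc 0 (t + 2) ∈ 𝓝[Ici 0] t :=
      mem_of_superset (inter_mem self_mem_nhdsWithin (mem_nhdsWithin_of_mem_nhds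
        (Iio_mem_nhds (by linarith : t < t + 2)))) fun s hs => ⟨hs.1, le_of_lt hs.2⟩
    have := h3.mono_of_mem_nhdsWithin hmem
    rwa [← key _ h2 t ht2] at this
  · exact hS _ (by linarith) _ ⟨ht, by linarith⟩

/-- If a `C¹` field is bounded on the region `{h_i > 0}` and strictly increases `h_i` wherever
`h_i = 0` on the boundary, then solutions starting in the region exist and stay there forever. -/
lemma exists_solution_mem_of_barrier [FiniteDimensional ℝ E] {ι : Type*} [Finite ι] {W : E → E}
    (hW : ContDiff ℝ 1 W) {h : ι → E → ℝ} (hh : ∀ i, Differentiable ℝ (h i)) {L : ℝ}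
    (hL : ∀ x, (∀ i, 0 < h i x) → ‖W x‖ ≤ L)
    (hbd : ∀ x, (∀ i, 0 ≤ h i x) → ∀ i, h i x = 0 → 0 < fderiv ℝ (h i) x (W x))
    {z₀ : E} (hz₀ : ∀ i, 0 < h i z₀) :
    ∃ z : ℝ → E, z 0 = z₀ ∧ (∀ t ≥ 0, HasDerivWithinAt z (W (z t)) (Ici 0) t) ∧
      ∀ t ≥ 0, ∀ i, 0 < h i (z t) := by
  refine exists_global_solution hW (S := {x | ∀ i, 0 < h i x}) fun T hT => ?_
  have hL0 : 0 ≤ L := (norm_nonneg _).trans (hL _ hz₀)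
  -- Inside the region the speed is at most `L`, so the norm cannot reach `R` before time `T`; the
  -- `1` makes this strict.
  let R := ‖z₀‖ + L * T + 1
  obtain ⟨C, -, hC⟩ := exists_bounded_lipschitz_retraction (E := E)
  obtain ⟨ρ, K, R', hK, hR', hid, -⟩ := hC R
  obtain ⟨K', hK'⟩ := exists_lipschitzOnWith_closedBall hW R'
  obtain ⟨B, hB⟩ := (isCompact_closedBall (0 : E) R').exists_bound_of_continuousOn
    hW.continuous.continuousOn
  have hρ : ∀ x, ρ x ∈ closedBall 0 R' := fun x => by simpa using hR' x
  have hB0 : 0 ≤ B := (norm_nonneg _).trans (hB _ (hρ 0))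
  obtain ⟨z, hz0, hz⟩ := exists_solution_of_bounded_lipschitz (f := fun _ x => W (ρ x))
    (K := K' * K) (L := B.toNNReal) hT.le
    (fun t _ => by
      rw [← lipschitzOnWith_univ]
      exact hK'.comp hK.lipschitzOnWith fun x _ => hρ x)
    (fun x => continuousOn_const)
    (fun t _ x => by rw [Real.coe_toNNReal _ hB0]; exact hB _ (hρ x)) z₀
  have hzc : ContinuousOn z (Icc 0 T) := continuousOn_of_hasDerivWithinAt hz
  let O : Set E := {x | ∀ i, 0 < h i x} ∩ {x | ‖x‖ < R}
  have hO : IsOpen O := by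
    refine IsOpen.inter ?_ (isOpen_lt continuous_norm continuous_const)
    rw [Set.ofPred_forall]
    exact isOpen_iInter_of_finite fun i => isOpen_lt continuous_const (hh i).continuous
  have hzO : ∀ t ∈ Icc 0 T, z t ∈ O := by
    by_contra! hcon
    let bad : Set ℝ := Icc 0 T ∩ z ⁻¹' Oᶜ
    have hbadc : IsClosed bad := hzc.preimage_isClosed_of_isClosed isClosed_Icc hO.isClosed_compl
    have hbadne : bad.Nonempty := hcon
    have hbadb : BddBelow bad := ⟨0, fun t ht => ht.1.1⟩
    obtain ⟨t, htb, htm⟩ : ∃ t ∈ bad, ∀ s ∈ Ico 0 t, z s ∈ O := by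
      refine ⟨sInf bad, hbadc.csInf_mem hbadne hbadb, fun s hs => ?_⟩
      by_contra hs'
      have hT' := (hbadc.csInf_mem hbadne hbadb).1.2
      exact absurd (csInf_le hbadb ⟨⟨hs.1, hs.2.le.trans hT'⟩, hs'⟩) (not_le.2 hs.2)
    obtain ⟨htI, htO⟩ := htb
    have hz0O : z 0 ∈ O := by
      rw [hz0]
      refine ⟨hz₀, ?_⟩
      change ‖z₀‖ < ‖z₀‖ + L * T + 1
      nlinarith [mul_nonneg hL0 hT.le]
    have ht0 : 0 < t := by
      rcases htI.1.eq_or_lt with h0 | h0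
      · rw [← h0] at htO; exact absurd hz0O htO
      · exact h0
    have hsub : Icc 0 t ⊆ Icc 0 T := Icc_subset_Icc_right htI.2
    have hnorm : ‖z t‖ < R := by
      have := norm_image_sub_le_of_norm_deriv_right_le_segment (f := z)
        (f' := fun s => W (ρ (z s))) (C := L) (hzc.mono hsub)
        (fun s hs => hasDerivWithinAt_Ici_of_Icc ⟨hs.1, hs.2.trans_le htI.2⟩
          (hz s (hsub (Ico_subset_Icc_self hs))))
        (fun s hs => by
          have := htm s hs
          rw [hid _ this.2.le]
          exact hL _ this.1) t ⟨ht0.le, le_rfl⟩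
      rw [hz0, sub_zero] at this
      have h1 : ‖z t‖ ≤ ‖z t - z₀‖ + ‖z₀‖ := by simpa using norm_add_le (z t - z₀) z₀
      have h2 : L * t ≤ L * T := mul_le_mul_of_nonneg_left htI.2 hL0
      change ‖z t‖ < ‖z₀‖ + L * T + 1
      linarith
    have hev : ∀ᶠ s in 𝓝[<] t, s ∈ Ioo 0 t :=
      inter_mem (mem_nhdsWithin_of_mem_nhds (Ioi_mem_nhds ht0)) self_mem_nhdsWithin
    have hev' : Icc 0 T ∈ 𝓝[<] t :=
      mem_of_superset hev fun s hs => ⟨hs.1.le, hs.2.le.trans htI.2⟩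
    have hcont : ∀ i, ContinuousWithinAt (fun s => h i (z s)) (Iio t) t := fun i =>
      (hh i).continuous.continuousAt.comp_continuousWithinAt
        ((hzc t htI).mono_of_mem_nhdsWithin hev')
    have hge : ∀ i, 0 ≤ h i (z t) := fun i =>
      ge_of_tendsto (hcont i) (hev.mono fun s hs => ((htm s ⟨hs.1.le, hs.2⟩).1 i).le)
    have : ∃ i, h i (z t) = 0 := by
      by_contra! hne
      exact htO ⟨fun i => lt_of_le_of_ne (hge i) (hne i).symm, hnorm⟩
    obtain ⟨i, hi⟩ := this
    have hpos := hbd _ hge i hi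
    have hd : HasDerivWithinAt (fun s => h i (z s)) (fderiv ℝ (h i) (z t) (W (z t))) (Iio t) t := by
      have h1 := hz t htI
      rw [hid _ hnorm.le] at h1
      exact ((hh i).differentiableAt.hasFDerivAt.comp_hasDerivWithinAt t h1).mono_of_mem_nhdsWithin
        hev'
    -- At the first exit time some `h i` vanishes, having been positive before: its left slopes are
    -- negative, against the positive derivative.
    rw [hasDerivWithinAt_iff_tendsto_slope' (by simp)] at hd
    obtain ⟨s, hs1, hs2⟩ := ((hd.eventually (lt_mem_nhds hpos)).and hev).exists
    have h3 := (htm s ⟨hs2.1.le, hs2.2⟩).1 i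
    rw [slope_def_field, hi, sub_zero] at hs1
    exact absurd hs1 (div_neg_of_pos_of_neg h3 (by linarith [hs2.2])).not_gt
  exact ⟨z, hz0, fun t ht => by simpa [hid _ (hzO t ht).2.le] using hz t ht,
    fun t ht => (hzO t ht).1⟩

end ODE

/-! ### Differentiable dependence on initial values. -/

section SmoothDependence

variable {E : Type*} [NormedAddCommGroup E] [NormedSpace ℝ E]

/-- A function that is strictly differentiable at all points of an open set is `C¹` there. -/
lemma contDiffOn_one_of_hasStrictFDerivAt {F : Type*} [NormedAddCommGroup F] [NormedSpace ℝ F]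
    {f : E → F} {f' : E → E →L[ℝ] F} {s : Set E} (hs : IsOpen s)
    (hf : ∀ x ∈ s, HasStrictFDerivAt f (f' x) x) : ContDiffOn ℝ 1 f s := by
  rw [← zero_add 1, contDiffOn_succ_iff_fderiv_of_isOpen hs]
  refine ⟨fun x hx => (hf x hx).hasFDerivAt.differentiableAt.differentiableWithinAt, by simp,
    contDiffOn_zero.2 ?_⟩
  intro x hx
  refine ContinuousAt.continuousWithinAt ?_
  rw [Metric.continuousAt_iff']
  intro ε hε
  have h1 := (hf x hx).isLittleO.def (half_pos hε)
  rw [nhds_prod_eq] at h1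
  obtain ⟨u, hu, huP⟩ := (eventually_prod_self_iff (r := fun y z =>
    ‖f y - f z - f' x (y - z)‖ ≤ ε / 2 * ‖y - z‖)).1 h1
  filter_upwards [hs.mem_nhds hx, eventually_eventually_nhds.2 hu] with y hy hyu
  rw [dist_eq_norm, (hf x hx).hasFDerivAt.fderiv]
  refine lt_of_le_of_lt ?_ (half_lt_self hε)
  -- Strict differentiability at `x` makes `f - f' x` Lipschitz with constant `ε / 2` near `x`,
  -- which bounds its derivative at `y`.
  have h2 : HasFDerivAt (fun z => f z - f' x z) (fderiv ℝ f y - f' x) y :=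
    ((hf y hy).hasFDerivAt.differentiableAt.hasFDerivAt).sub (f' x).hasFDerivAt
  refine h2.le_of_lip' (half_pos hε).le ?_
  filter_upwards [hyu] with z hz
  have := huP z hz y hyu.self_of_nhds
  rw [map_sub] at this
  convert this using 2
  abel

/-- The time-one map of a `C¹` field is `C¹` wherever the solutions exist and are locally
bounded. -/
theorem contDiffOn_time_one_map [FiniteDimensional ℝ E] {W : E → E} (hW : ContDiff ℝ 1 W)
    {Ω : Set E} (hΩ : IsOpen Ω) {Φ : E → ℝ → E} (h0 : ∀ x ∈ Ω, Φ x 0 = x)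
    (hΦ : ∀ x ∈ Ω, ∀ t ∈ Icc (0 : ℝ) 1,
      HasDerivWithinAt (Φ x) (W (Φ x t)) (Icc 0 1) t)
    (hb : ∀ x ∈ Ω, ∃ R, ∀ᶠ y in 𝓝 x, ∀ t ∈ Icc (0 : ℝ) 1, ‖Φ y t‖ ≤ R) :
    ContDiffOn ℝ 1 (fun x => Φ x 1) Ω := by
  have key : ∀ x ∈ Ω, ∃ A : E →L[ℝ] E, HasStrictFDerivAt (fun x => Φ x 1) A x := by
    intro x hx
    obtain ⟨R, hR⟩ := hb x hx
    obtain ⟨K, hK⟩ := exists_lipschitzOnWith_closedBall hW R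
    have hDW : Continuous (fderiv ℝ W) := hW.continuous_fderiv (by simp)
    have hdW : Differentiable ℝ W := hW.differentiable (by simp)
    obtain ⟨a, ha⟩ := (isCompact_closedBall (0 : E) R).exists_bound_of_continuousOn
      hDW.continuousOn
    have hR' : ∀ᶠ y in 𝓝 x, y ∈ Ω ∧ ∀ t ∈ Icc (0 : ℝ) 1, Φ y t ∈ closedBall 0 R := by
      filter_upwards [hR, hΩ.mem_nhds hx] with y hy hyΩ
      exact ⟨hyΩ, fun t ht => by simpa using hy t ht⟩
    have hxR := hR'.self_of_nhds.2
    obtain ⟨M, hM0, hM⟩ := exists_resolvent (A := fun t => fderiv ℝ W (Φ x t)) zero_le_one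
      (hDW.comp_continuousOn (continuousOn_of_hasDerivWithinAt (hΦ x hx)))
    have ha0 : 0 ≤ a := (norm_nonneg _).trans (ha _ (hxR 0 ⟨le_rfl, zero_le_one⟩))
    have hlip : ∀ y z, (y ∈ Ω ∧ ∀ t ∈ Icc (0 : ℝ) 1, Φ y t ∈ closedBall 0 R) →
        (z ∈ Ω ∧ ∀ t ∈ Icc (0 : ℝ) 1, Φ z t ∈ closedBall 0 R) → ∀ t ∈ Icc (0 : ℝ) 1,
        ‖Φ y t - Φ z t‖ ≤ Real.exp K * ‖y - z‖ := by
      intro y z hy hz t ht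
      have := norm_le_gronwall_Icc (z := fun t => Φ y t - Φ z t) (δ := ‖y - z‖) (K := K) (ε := 0)
        (fun s hs => (hΦ y hy.1 s hs).sub (hΦ z hz.1 s hs)) (by simp [h0 _ hy.1, h0 _ hz.1])
        (fun s hs => by
          have := hK.dist_le_mul _ (hy.2 s (Ico_subset_Icc_self hs)) _
            (hz.2 s (Ico_subset_Icc_self hs))
          simpa [dist_eq_norm] using this) t ht
      refine this.trans ?_
      rw [gronwallBound_ε0, mul_comm]
      refine mul_le_mul_of_nonneg_right (Real.exp_le_exp.2 ?_) (norm_nonneg _)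
      nlinarith [ht.1, ht.2, K.coe_nonneg]
    refine ⟨M 1, HasStrictFDerivAt.of_isLittleO (Asymptotics.isLittleO_iff.2 fun c hc => ?_)⟩
    -- The factor `exp K` bounds the spreading of solutions and `exp (a + 1)` is the Grönwall factor
    -- of the linearized equation. The rate `a + 1` replaces `a` to be nonzero in the closed
    -- Grönwall formula. The derivative sought is the resolvent at time one.
    let η : ℝ := c / (Real.exp K * Real.exp (a + 1))
    have hη : 0 < η := by positivity
    obtain ⟨δ, hδ, hδu⟩ := Metric.uniformContinuousOn_iff.1
      ((isCompact_closedBall (0 : E) R).uniformContinuousOn_of_continuous hDW.continuousOn) η hη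
    have hnear : ∀ᶠ y in 𝓝 x, (y ∈ Ω ∧ ∀ t ∈ Icc (0 : ℝ) 1, Φ y t ∈ closedBall 0 R) ∧
        Real.exp K * ‖y - x‖ < δ := by
      refine hR'.and ?_
      have : Tendsto (fun y => Real.exp K * ‖y - x‖) (𝓝 x) (𝓝 (Real.exp K * ‖x - x‖)) :=
        (continuous_const.mul (continuous_id.sub continuous_const).norm).tendsto x
      exact this.eventually (gt_mem_nhds (by simpa using hδ))
    rw [nhds_prod_eq]
    filter_upwards [hnear.prod_mk hnear] with p hp
    obtain ⟨⟨hy, hyδ⟩, hz, hzδ⟩ := hp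
    set y := p.1
    set z := p.2
    have hWyz : ∀ t ∈ Icc (0 : ℝ) 1, ‖W (Φ y t) - W (Φ z t) -
        fderiv ℝ W (Φ x t) (Φ y t - Φ z t)‖ ≤ η * ‖Φ y t - Φ z t‖ := by
      intro t ht
      have hball : ∀ w, (w ∈ Ω ∧ ∀ t ∈ Icc (0 : ℝ) 1, Φ w t ∈ closedBall 0 R) →
          Real.exp K * ‖w - x‖ < δ → Φ w t ∈ closedBall 0 R ∩ ball (Φ x t) δ := by
        intro w hw hwδ
        refine ⟨hw.2 t ht, ?_⟩
        rw [mem_ball, dist_eq_norm]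
        exact (hlip w x hw hR'.self_of_nhds t ht).trans_lt hwδ
      refine Convex.norm_image_sub_le_of_norm_fderiv_le' (𝕜 := ℝ)
        (s := closedBall 0 R ∩ ball (Φ x t) δ) (fun w _ => hdW w) (fun w hw => ?_)
        ((convex_closedBall _ _).inter (convex_ball _ _)) (hball z hz hzδ) (hball y hy hyδ)
      rw [← dist_eq_norm]
      exact (hδu w hw.1 (Φ x t) (hxR t ht) hw.2).le
    have hfin := norm_le_gronwall_Icc (z := fun t => Φ y t - Φ z t - M t (y - z)) (δ := 0)
      (K := a + 1) (ε := η * (Real.exp K * ‖y - z‖))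
      (fun s hs => ((hΦ y hy.1 s hs).sub (hΦ z hz.1 s hs)).sub
        ((ContinuousLinearMap.apply ℝ E (y - z)).hasFDerivAt.comp_hasDerivWithinAt s (hM s hs)))
      (by simp [h0 _ hy.1, h0 _ hz.1, hM0])
      (fun s hs => by
        have hs' := Ico_subset_Icc_self hs
        have e1 : W (Φ y s) - W (Φ z s) -
            (ContinuousLinearMap.apply ℝ E (y - z)) (fderiv ℝ W (Φ x s) ∘L M s) =
            (W (Φ y s) - W (Φ z s) - fderiv ℝ W (Φ x s) (Φ y s - Φ z s)) +
              fderiv ℝ W (Φ x s) (Φ y s - Φ z s - M s (y - z)) := by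
          have e2 : (ContinuousLinearMap.apply ℝ E (y - z)) (fderiv ℝ W (Φ x s) ∘L M s) =
            fderiv ℝ W (Φ x s) (M s (y - z)) := rfl
          rw [e2, map_sub _ _ (M s (y - z))]
          abel
        rw [e1]
        refine (norm_add_le _ _).trans ?_
        rw [add_comm]
        refine add_le_add (((fderiv ℝ W (Φ x s)).le_opNorm _).trans ?_)
          ((hWyz s hs').trans (mul_le_mul_of_nonneg_left (hlip y z hy hz s hs') hη.le))
        exact mul_le_mul_of_nonneg_right ((ha _ (hxR s hs')).trans (by linarith)) (norm_nonneg _))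
      1 ⟨zero_le_one, le_rfl⟩
    refine hfin.trans ?_
    rw [gronwallBound_of_K_ne_0 (by positivity)]
    have hden : η * (Real.exp K * ‖y - z‖) / (a + 1) ≤ η * (Real.exp K * ‖y - z‖) :=
      div_le_self (by positivity) (by linarith)
    have hexp : 0 ≤ Real.exp (a + 1) - 1 := by
      linarith [Real.one_le_exp (by linarith : 0 ≤ a + 1)]
    calc 0 * Real.exp ((a + 1) * (1 - 0)) + η * (Real.exp K * ‖y - z‖) / (a + 1) *
          (Real.exp ((a + 1) * (1 - 0)) - 1)
        = η * (Real.exp K * ‖y - z‖) / (a + 1) * (Real.exp (a + 1) - 1) := by simp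
      _ ≤ η * (Real.exp K * ‖y - z‖) * (Real.exp (a + 1) - 1) :=
          mul_le_mul_of_nonneg_right hden hexp
      _ ≤ η * (Real.exp K * ‖y - z‖) * Real.exp (a + 1) :=
          mul_le_mul_of_nonneg_left (by linarith) (by positivity)
      _ = c * ‖y - z‖ := by
          simp only [η]
          field_simp
  choose! A hA using key
  exact contDiffOn_one_of_hasStrictFDerivAt hΩ hA

end SmoothDependence

/-! ### Mean value estimates on half-lines. -/

section Calculus

variable {E : Type*} [NormedAddCommGroup E] [NormedSpace ℝ E]

lemma norm_sub_le_of_hasDerivWithinAt_Ici {f f' : ℝ → E} {a M : ℝ}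
    (hf : ∀ t ≥ a, HasDerivWithinAt f (f' t) (Ici a) t) (hM : ∀ t ≥ a, ‖f' t‖ ≤ M) {s t : ℝ}
    (hs : a ≤ s) (ht : a ≤ t) : ‖f t - f s‖ ≤ M * |t - s| :=
  (convex_Ici a).norm_image_sub_le_of_norm_hasDerivWithin_le (fun x hx => hf x hx)
    (fun x hx => hM x hx) hs ht

lemma mul_sub_le_of_hasDerivWithinAt_Ici {f f' : ℝ → ℝ} {a m : ℝ}
    (hf : ∀ t ≥ a, HasDerivWithinAt f (f' t) (Ici a) t) (hm : ∀ t ≥ a, m ≤ f' t) {s t : ℝ}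
    (hs : a ≤ s) (hst : s ≤ t) : m * (t - s) ≤ f t - f s := by
  have hd : ∀ x ∈ interior (Ici a), HasDerivAt f (f' x) x := fun x hx => by
    rw [interior_Ici] at hx
    exact (hf x (le_of_lt hx)).hasDerivAt (Ici_mem_nhds hx)
  refine (convex_Ici a).mul_sub_le_image_sub_of_le_deriv
    (continuousOn_of_hasDerivWithinAt (fun x hx => hf x hx))
    (fun x hx => (hd x hx).differentiableAt.differentiableWithinAt)
    (fun x hx => ?_) s hs t (hs.trans hst) hst
  rw [(hd x hx).deriv]
  exact hm x (interior_subset hx)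

end Calculus

/-! ### Flows that contract with respect to a phase. -/

/-- Data of a `C¹` field `V` on an open set `C` whose `l`-th component is positive there, so that
`x_l` can serve as a phase. With respect to the phase, solutions contract towards each other with
instantaneous rate `g` up to an error `κ`, and `g + κ` is negative on average. -/
structure PhaseContraction {N : ℕ} (l : Fin N) (C : Set (Fin N → ℝ))
    (V : (Fin N → ℝ) → Fin N → ℝ) (k : (Fin N → ℝ) → ℝ) (g : ℝ → ℝ) (c L κ C₁ K₀ β : ℝ) :
    Prop where
  isOpen : IsOpen C
  contDiff_field : ContDiff ℝ 1 V
  contDiff_recip : ContDiff ℝ 1 k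
  recip_eq : ∀ x ∈ C, k x = (V x l)⁻¹
  c_pos : 0 < c
  le_speed : ∀ x ∈ C, c ≤ V x l
  norm_le : ∀ x ∈ C, ‖V x‖ ≤ L
  contract : ∀ x ∈ C, ∀ y ∈ C, x l = y l →
    ‖k x • V x - k y • V y - g (x l) • (x - y)‖ ≤ κ * ‖x - y‖
  recip_lip : ∀ x ∈ C, ∀ y ∈ C, x l = y l → |k x - k y| ≤ C₁ * ‖x - y‖
  continuous_rate : Continuous g
  β_pos : 0 < β
  K₀_nonneg : 0 ≤ K₀
  C₁_nonneg : 0 ≤ C₁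
  average : ∀ a b, a ≤ b →
    Real.exp (∫ s in a..b, g s) * Real.exp (κ * (b - a)) ≤ K₀ * Real.exp (-β * (b - a))
  exists_flow : ∀ x ∈ C, ∃ z : ℝ → (Fin N → ℝ) × ℝ, z 0 = (x, 0) ∧ ∀ s ≥ 0, (z s).1 ∈ C ∧
    HasDerivWithinAt z (k (z s).1 • V (z s).1, k (z s).1) (Ici 0) s

/-- `P x ν` is the point of the orbit of `x` at which the phase `x_l` equals `ν`, and `T x ν` is
the time at which it is reached. -/
structure IsPhaseFlow {N : ℕ} (l : Fin N) (C : Set (Fin N → ℝ))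
    (V : (Fin N → ℝ) → Fin N → ℝ) (k : (Fin N → ℝ) → ℝ)
    (P : (Fin N → ℝ) → ℝ → Fin N → ℝ) (T : (Fin N → ℝ) → ℝ → ℝ) : Prop where
  P_self : ∀ x ∈ C, P x (x l) = x
  T_self : ∀ x ∈ C, T x (x l) = 0
  mem : ∀ x ∈ C, ∀ ν ≥ x l, P x ν ∈ C
  phase : ∀ x ∈ C, ∀ ν ≥ x l, P x ν l = ν
  hasDeriv_P : ∀ x ∈ C, ∀ ν ≥ x l,
    HasDerivWithinAt (P x) (k (P x ν) • V (P x ν)) (Ici (x l)) ν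
  hasDeriv_T : ∀ x ∈ C, ∀ ν ≥ x l, HasDerivWithinAt (T x) (k (P x ν)) (Ici (x l)) ν

namespace PhaseContraction

variable {N : ℕ} {l : Fin N} {C : Set (Fin N → ℝ)} {V : (Fin N → ℝ) → Fin N → ℝ}
  {k : (Fin N → ℝ) → ℝ} {g : ℝ → ℝ} {c L κ C₁ K₀ β : ℝ}
  {P : (Fin N → ℝ) → ℝ → Fin N → ℝ} {T : (Fin N → ℝ) → ℝ → ℝ}

lemma speed_pos (h : PhaseContraction l C V k g c L κ C₁ K₀ β) {x : Fin N → ℝ} (hx : x ∈ C) :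
    0 < V x l :=
  h.c_pos.trans_le (h.le_speed x hx)

lemma recip_mul (h : PhaseContraction l C V k g c L κ C₁ K₀ β) {x : Fin N → ℝ} (hx : x ∈ C) :
    k x * V x l = 1 := by
  rw [h.recip_eq x hx, inv_mul_cancel₀ (h.speed_pos hx).ne']

lemma recip_pos (h : PhaseContraction l C V k g c L κ C₁ K₀ β) {x : Fin N → ℝ} (hx : x ∈ C) :
    0 < k x := by
  rw [h.recip_eq x hx]
  exact inv_pos.2 (h.speed_pos hx)

lemma recip_le (h : PhaseContraction l C V k g c L κ C₁ K₀ β) {x : Fin N → ℝ} (hx : x ∈ C) :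
    k x ≤ c⁻¹ := by
  rw [h.recip_eq x hx]
  exact inv_anti₀ h.c_pos (h.le_speed x hx)

lemma speed_le (h : PhaseContraction l C V k g c L κ C₁ K₀ β) {x : Fin N → ℝ} (hx : x ∈ C) :
    V x l ≤ L :=
  (le_abs_self _).trans ((norm_le_pi_norm (V x) l).trans (h.norm_le x hx))

lemma L_pos (h : PhaseContraction l C V k g c L κ C₁ K₀ β) {x : Fin N → ℝ} (hx : x ∈ C) :
    0 < L :=
  (h.speed_pos hx).trans_le (h.speed_le hx)

lemma le_recip (h : PhaseContraction l C V k g c L κ C₁ K₀ β) {x : Fin N → ℝ} (hx : x ∈ C) :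
    L⁻¹ ≤ k x := by
  rw [h.recip_eq x hx]
  exact inv_anti₀ (h.speed_pos hx) (h.speed_le hx)

lemma norm_rescaled_le (h : PhaseContraction l C V k g c L κ C₁ K₀ β) {x : Fin N → ℝ}
    (hx : x ∈ C) : ‖k x • V x‖ ≤ L / c := by
  rw [norm_smul, Real.norm_eq_abs, abs_of_pos (h.recip_pos hx), div_eq_inv_mul]
  exact mul_le_mul (h.recip_le hx) (h.norm_le x hx) (norm_nonneg _) (inv_pos.2 h.c_pos).le

lemma contDiff_rescaled (h : PhaseContraction l C V k g c L κ C₁ K₀ β) :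
    ContDiff ℝ 1 (fun x => k x • V x) :=
  h.contDiff_recip.smul h.contDiff_field

/-- Under `k • V` the `l`-th coordinate has unit speed, so shifting the parameter by `x l` turns it
into the phase. The second component integrates `k = dt/dν` and thus records elapsed time. -/
lemma exists_isPhaseFlow (h : PhaseContraction l C V k g c L κ C₁ K₀ β) :
    ∃ P T, IsPhaseFlow l C V k P T := by
  choose! z hz0 hz using h.exists_flow
  have hd : ∀ x ∈ C, ∀ ν ≥ x l, HasDerivWithinAt (fun μ => z x (μ - x l))
      (k (z x (ν - x l)).1 • V (z x (ν - x l)).1, k (z x (ν - x l)).1) (Ici (x l)) ν := by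
    intro x hx ν hν
    have h1 := (hz x hx (ν - x l) (by linarith [hν])).2
    have h2 : HasDerivWithinAt (fun μ : ℝ => μ - x l) 1 (Ici (x l)) ν :=
      (hasDerivWithinAt_id ν _).sub_const _
    have := h1.scomp (t' := Ici 0) ν h2 (fun μ hμ => by simpa using hμ)
    rw [one_smul] at this
    exact this
  refine ⟨fun x ν => (z x (ν - x l)).1, fun x ν => (z x (ν - x l)).2, ?_⟩
  have hdP : ∀ x ∈ C, ∀ ν ≥ x l, HasDerivWithinAt (fun μ => (z x (μ - x l)).1)
      (k (z x (ν - x l)).1 • V (z x (ν - x l)).1) (Ici (x l)) ν := fun x hx ν hν =>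
    (ContinuousLinearMap.fst ℝ (Fin N → ℝ) ℝ).hasFDerivAt.comp_hasDerivWithinAt ν (hd x hx ν hν)
  have hmem : ∀ x ∈ C, ∀ ν ≥ x l, (z x (ν - x l)).1 ∈ C := fun x hx ν hν =>
    (hz x hx (ν - x l) (by linarith [hν])).1
  refine ⟨fun x hx => by simp [hz0 x hx], fun x hx => by simp [hz0 x hx], hmem,
    fun x hx ν hν => ?_, hdP, fun x hx ν hν =>
    (ContinuousLinearMap.snd ℝ (Fin N → ℝ) ℝ).hasFDerivAt.comp_hasDerivWithinAt ν (hd x hx ν hν)⟩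
  have h3 := norm_sub_le_of_hasDerivWithinAt_Ici (M := 0)
    (f := fun μ => (z x (μ - x l)).1 l - μ) (a := x l)
    (fun t ht => ((hasDerivWithinAt_pi.1 (hdP x hx t ht)) l).sub (hasDerivWithinAt_id t _))
    (fun t ht => by simp [h.recip_mul (hmem x hx t ht)]) le_rfl hν
  simp only [zero_mul, norm_le_zero_iff, sub_self, hz0 x hx] at h3
  change (z x (ν - x l)).1 l = ν
  linarith

section

variable (h : PhaseContraction l C V k g c L κ C₁ K₀ β) (hP : IsPhaseFlow l C V k P T)
include h hP

lemma norm_P_sub_le {x : Fin N → ℝ} (hx : x ∈ C) {ν μ : ℝ} (hν : x l ≤ ν) (hμ : x l ≤ μ) :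
    ‖P x ν - P x μ‖ ≤ L / c * |ν - μ| :=
  norm_sub_le_of_hasDerivWithinAt_Ici (hP.hasDeriv_P x hx)
    (fun t ht => h.norm_rescaled_le (hP.mem x hx t ht)) hμ hν

lemma abs_T_sub_le {x : Fin N → ℝ} (hx : x ∈ C) {ν μ : ℝ} (hν : x l ≤ ν) (hμ : x l ≤ μ) :
    |T x ν - T x μ| ≤ c⁻¹ * |ν - μ| :=
  norm_sub_le_of_hasDerivWithinAt_Ici (hP.hasDeriv_T x hx)
    (fun t ht => by
      rw [Real.norm_eq_abs, abs_of_pos (h.recip_pos (hP.mem x hx t ht))]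
      exact h.recip_le (hP.mem x hx t ht)) hμ hν

/-- Since `dT/dν = k ≥ 1/L`, a time lag controls a phase difference along one orbit. -/
lemma abs_sub_le_T {x : Fin N → ℝ} (hx : x ∈ C) {ν μ : ℝ} (hν : x l ≤ ν) (hμ : x l ≤ μ) :
    |ν - μ| ≤ L * |T x ν - T x μ| := by
  have key : ∀ ν μ, x l ≤ μ → μ ≤ ν → |ν - μ| ≤ L * |T x ν - T x μ| := by
    intro ν μ hμ hμν
    have h1 := mul_sub_le_of_hasDerivWithinAt_Ici (hP.hasDeriv_T x hx)
      (fun t ht => h.le_recip (hP.mem x hx t ht)) hμ hμν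
    rw [abs_of_nonneg (sub_nonneg.2 hμν)]
    have hL := h.L_pos hx
    have h2 := mul_le_mul_of_nonneg_left (h1.trans (le_abs_self _)) hL.le
    rwa [mul_inv_cancel_left₀ hL.ne'] at h2
  rcases le_total μ ν with hl | hl
  · exact key ν μ hμ hl
  · rw [abs_sub_comm, abs_sub_comm (T x ν)]
    exact key μ ν hν hl

/-- After multiplication by `exp(-∫ g)` the difference grows at rate at most `κ`, by `contract`;
Grönwall and `average` then give decay at rate `β`. -/
lemma norm_P_sub_P_le {x y : Fin N → ℝ} (hx : x ∈ C) (hy : y ∈ C) {a ν : ℝ} (hxa : x l ≤ a)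
    (hya : y l ≤ a) (hν : a ≤ ν) :
    ‖P x ν - P y ν‖ ≤ K₀ * Real.exp (-β * (ν - a)) * ‖P x a - P y a‖ := by
  let G : ℝ → ℝ := fun ν => ∫ s in a..ν, g s
  have hG : ∀ t, HasDerivAt G (g t) t := fun t =>
    intervalIntegral.integral_hasDerivAt_right (h.continuous_rate.intervalIntegrable _ _)
      (h.continuous_rate.stronglyMeasurableAtFilter _ _) h.continuous_rate.continuousAt
  have hsub : Icc a ν ⊆ Ici a := Icc_subset_Ici_self
  have hd : ∀ t ∈ Icc a ν, HasDerivWithinAt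
      (fun t => Real.exp (-G t) • (P x t - P y t))
      (Real.exp (-G t) • (k (P x t) • V (P x t) - k (P y t) • V (P y t) - g t • (P x t - P y t)))
      (Icc a ν) t := by
    intro t ht
    have h1 := ((hP.hasDeriv_P x hx t (hxa.trans ht.1)).mono
      (Icc_subset_Ici_self.trans (Ici_subset_Ici.2 hxa) : Icc a ν ⊆ _)).sub
      ((hP.hasDeriv_P y hy t (hya.trans ht.1)).mono
      (Icc_subset_Ici_self.trans (Ici_subset_Ici.2 hya) : Icc a ν ⊆ _))
    have h2 := ((hG t).neg.exp.hasDerivWithinAt (s := Icc a ν)).smul h1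
    refine h2.congr_deriv ?_
    simp only [Pi.sub_apply, smul_sub, smul_smul, mul_neg, neg_smul]
    abel
  have hgr := norm_le_gronwall_Icc (K := κ) (ε := 0) (δ := ‖P x a - P y a‖) hd
    (by simp [G])
    (fun t ht => by
      have ht' : a ≤ t := ht.1
      have h1 := h.contract _ (hP.mem x hx t (hxa.trans ht')) _ (hP.mem y hy t (hya.trans ht'))
        (by rw [hP.phase x hx t (hxa.trans ht'), hP.phase y hy t (hya.trans ht')])
      rw [hP.phase x hx t (hxa.trans ht')] at h1
      rw [norm_smul, norm_smul, add_zero, mul_left_comm]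
      exact mul_le_mul_of_nonneg_left h1 (norm_nonneg _)) ν ⟨hν, le_rfl⟩
  rw [gronwallBound_ε0, norm_smul, Real.norm_eq_abs, Real.abs_exp, Real.exp_neg,
    inv_mul_le_iff₀ (Real.exp_pos _)] at hgr
  refine hgr.trans ?_
  calc Real.exp (G ν) * (‖P x a - P y a‖ * Real.exp (κ * (ν - a)))
      = Real.exp (G ν) * Real.exp (κ * (ν - a)) * ‖P x a - P y a‖ := by ring
    _ ≤ _ := mul_le_mul_of_nonneg_right (h.average a ν hν) (norm_nonneg _)

/-- The lag changes at rate `k (P x ν) - k (P y ν)`, which is Lipschitz in the exponentially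
decaying distance at equal phase. Integrating from `ν` on bounds all later changes by the tail of
the exponential. -/
lemma abs_T_increment_le {x y : Fin N → ℝ} (hx : x ∈ C) (hy : y ∈ C) {a ν ν' : ℝ} (hxa : x l ≤ a)
    (hya : y l ≤ a) (hν : a ≤ ν) (hν' : ν ≤ ν') :
    |(T x ν' - T y ν') - (T x ν - T y ν)| ≤
      C₁ * K₀ / β * Real.exp (-β * (ν - a)) * ‖P x a - P y a‖ := by
  let Q := C₁ * K₀ / β * ‖P x a - P y a‖
  have hQ : 0 ≤ Q := mul_nonneg (div_nonneg (mul_nonneg h.C₁_nonneg h.K₀_nonneg) h.β_pos.le)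
    (norm_nonneg _)
  have hβ := h.β_pos
  have hd : ∀ t ≥ a, HasDerivWithinAt (fun t => T x t - T y t - (T x ν - T y ν))
      (k (P x t) - k (P y t)) (Ici a) t := fun t ht =>
    (((hP.hasDeriv_T x hx t (hxa.trans ht)).mono (Ici_subset_Ici.2 hxa)).sub
      ((hP.hasDeriv_T y hy t (hya.trans ht)).mono (Ici_subset_Ici.2 hya))).sub_const _
  have hB : ∀ t, HasDerivAt (fun t => Q * (Real.exp (-β * (ν - a)) - Real.exp (-β * (t - a))))
      (Q * (β * Real.exp (-β * (t - a)))) t := by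
    intro t
    have h1 : HasDerivAt (fun t => -β * (t - a)) (-β * 1) t :=
      ((hasDerivAt_id t).sub_const a).const_mul (-β)
    refine ((h1.exp.const_sub _).const_mul Q).congr_deriv ?_
    ring
  have := image_norm_le_of_norm_deriv_right_le_deriv_boundary (a := ν) (b := ν')
    (continuousOn_of_hasDerivWithinAt (fun t ht => (hd t (hν.trans ht.1)).mono
      (Icc_subset_Ici_self.trans (Ici_subset_Ici.2 hν))))
    (fun t ht => (hd t (hν.trans ht.1)).mono (Ici_subset_Ici.2 (hν.trans ht.1)))
    (by simp) hB
    (fun t ht => by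
      have hat : a ≤ t := hν.trans ht.1
      have h1 := h.recip_lip _ (hP.mem x hx t (hxa.trans hat)) _ (hP.mem y hy t (hya.trans hat))
        (by rw [hP.phase x hx t (hxa.trans hat), hP.phase y hy t (hya.trans hat)])
      have h2 := h.norm_P_sub_P_le hP hx hy hxa hya hat
      calc ‖k (P x t) - k (P y t)‖ ≤ C₁ * ‖P x t - P y t‖ := h1
        _ ≤ C₁ * (K₀ * Real.exp (-β * (t - a)) * ‖P x a - P y a‖) :=
          mul_le_mul_of_nonneg_left h2 h.C₁_nonneg
        _ = Q * (β * Real.exp (-β * (t - a))) := by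
          simp only [Q]; field_simp) (right_mem_Icc.2 hν')
  rw [Real.norm_eq_abs] at this
  refine this.trans ?_
  calc Q * (Real.exp (-β * (ν - a)) - Real.exp (-β * (ν' - a)))
      ≤ Q * Real.exp (-β * (ν - a)) :=
        mul_le_mul_of_nonneg_left (by linarith [Real.exp_pos (-β * (ν' - a))]) hQ
    _ = _ := by simp only [Q]; ring

/-- The larger initial phase is the first at which both orbits are defined; reaching it moves each
point by at most `L / c` times the initial phase difference. -/
lemma norm_P_section_le {x y : Fin N → ℝ} (hx : x ∈ C) (hy : y ∈ C) {a : ℝ}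
    (ha : a = max (x l) (y l)) :
    ‖P x a - P y a‖ ≤ (1 + 2 * (L / c)) * ‖x - y‖ := by
  have hxy := norm_le_pi_norm (x - y) l
  rw [Pi.sub_apply, Real.norm_eq_abs] at hxy
  have hLc : 0 ≤ L / c := (div_pos (h.L_pos hx) h.c_pos).le
  have h1 := h.norm_P_sub_le hP hx (ν := a) (μ := x l) (by simp [ha]) le_rfl
  have h2 := h.norm_P_sub_le hP hy (ν := a) (μ := y l) (by simp [ha]) le_rfl
  rw [hP.P_self x hx] at h1
  rw [hP.P_self y hy] at h2
  have hax : |a - x l| ≤ ‖x - y‖ := (by rw [ha]; grind : |a - x l| ≤ |x l - y l|).trans hxy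
  have hay : |a - y l| ≤ ‖x - y‖ := (by rw [ha]; grind : |a - y l| ≤ |x l - y l|).trans hxy
  have h3 : ‖P x a - P y a‖ ≤ ‖P x a - x‖ + ‖x - y‖ + ‖P y a - y‖ := by
    have e : P x a - P y a = (P x a - x) + (x - y) - (P y a - y) := by abel
    rw [e]
    exact (norm_sub_le _ _).trans (add_le_add_left (norm_add_le _ _) _)
  have h4 := mul_le_mul_of_nonneg_left hax hLc
  have h5 := mul_le_mul_of_nonneg_left hay hLc
  linarith

lemma abs_T_section_le {x y : Fin N → ℝ} (hx : x ∈ C) (hy : y ∈ C) {a : ℝ}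
    (ha : a = max (x l) (y l)) : |T x a - T y a| ≤ 2 * c⁻¹ * ‖x - y‖ := by
  have hxy := norm_le_pi_norm (x - y) l
  rw [Pi.sub_apply, Real.norm_eq_abs] at hxy
  have hc : 0 ≤ c⁻¹ := (inv_pos.2 h.c_pos).le
  have h1 := h.abs_T_sub_le hP hx (ν := a) (μ := x l) (by simp [ha]) le_rfl
  have h2 := h.abs_T_sub_le hP hy (ν := a) (μ := y l) (by simp [ha]) le_rfl
  rw [hP.T_self x hx, sub_zero] at h1
  rw [hP.T_self y hy, sub_zero] at h2
  have hax : |a - x l| ≤ ‖x - y‖ := (by rw [ha]; grind : |a - x l| ≤ |x l - y l|).trans hxy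
  have hay : |a - y l| ≤ ‖x - y‖ := (by rw [ha]; grind : |a - y l| ≤ |x l - y l|).trans hxy
  have h4 := mul_le_mul_of_nonneg_left hax hc
  have h5 := mul_le_mul_of_nonneg_left hay hc
  have h6 := abs_sub (T x a) (T y a)
  linarith

end

end PhaseContraction

/-! ### From the phase back to the original time. -/

namespace PhaseContraction

variable {N : ℕ} {l : Fin N} {C : Set (Fin N → ℝ)} {V : (Fin N → ℝ) → Fin N → ℝ}
  {k : (Fin N → ℝ) → ℝ} {g : ℝ → ℝ} {c L κ C₁ K₀ β : ℝ}
  {P : (Fin N → ℝ) → ℝ → Fin N → ℝ} {T : (Fin N → ℝ) → ℝ → ℝ}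
  (h : PhaseContraction l C V k g c L κ C₁ K₀ β) (hP : IsPhaseFlow l C V k P T)
include h hP

/-- A solution in the original time is the phase flow evaluated at the current phase. -/
lemma solution_eq_phaseFlow {x : Fin N → ℝ} (hx : x ∈ C) {t₀ : ℝ} {X : ℝ → Fin N → ℝ}
    (hX0 : X t₀ = x) (hXC : ∀ t ≥ t₀, X t ∈ C)
    (hX : ∀ t ≥ t₀, HasDerivWithinAt X (V (X t)) (Ici t₀) t) {t : ℝ} (ht : t₀ ≤ t) :
    x l + c * (t - t₀) ≤ X t l ∧ x l ≤ X t l ∧ X t = P x (X t l) ∧ T x (X t l) = t - t₀ := by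
  have hs : ∀ t ≥ t₀, HasDerivWithinAt (fun t => X t l) (V (X t) l) (Ici t₀) t :=
    fun t ht => hasDerivWithinAt_pi.1 (hX t ht) l
  have hle : ∀ t ≥ t₀, x l + c * (t - t₀) ≤ X t l := fun t ht => by
    have := mul_sub_le_of_hasDerivWithinAt_Ici hs (fun t ht => h.le_speed _ (hXC t ht)) le_rfl ht
    rw [hX0] at this
    linarith
  have hxl : ∀ t ≥ t₀, x l ≤ X t l := fun t ht =>
    le_trans (by nlinarith [h.c_pos, sub_nonneg.2 ht]) (hle t ht)
  have hPs : ∀ t ≥ t₀, HasDerivWithinAt (fun t => P x (X t l))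
      (V (X t) l • (k (P x (X t l)) • V (P x (X t l)))) (Ici t₀) t := fun t ht =>
    (hP.hasDeriv_P x hx _ (hxl t ht)).scomp t (hs t ht) fun s hs => hxl s hs
  have hTs : ∀ t ≥ t₀, HasDerivWithinAt (fun t => T x (X t l))
      (V (X t) l • k (P x (X t l))) (Ici t₀) t := fun t ht =>
    (hP.hasDeriv_T x hx _ (hxl t ht)).scomp t (hs t ht) fun s hs => hxl s hs
  have heq : ∀ t ≥ t₀, X t = P x (X t l) := fun t ht => by
    have hκ : ContinuousOn (fun t => V (X t) l) (Icc t₀ t) :=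
      ((continuous_apply l).comp h.contDiff_field.continuous).comp_continuousOn
        (continuousOn_of_hasDerivWithinAt fun s hs => (hX s hs.1).mono Icc_subset_Ici_self)
    -- Both curves solve `y' = V_l(X(t)) · (k V)(y)`, an equation with a time-dependent scalar
    -- factor.
    refine solution_unique h.contDiff_rescaled hκ (fun s hs => ?_)
      (fun s hs => (hPs s hs.1).mono Icc_subset_Ici_self)
      (by rw [hX0, hP.P_self x hx]) ⟨ht, le_rfl⟩
    have := (hX s hs.1).mono (Icc_subset_Ici_self : Icc t₀ t ⊆ _)
    rwa [smul_smul, mul_comm, h.recip_mul (hXC s hs.1), one_smul]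
  refine ⟨hle t ht, hxl t ht, heq t ht, ?_⟩
  have h3 := norm_sub_le_of_hasDerivWithinAt_Ici (M := 0)
    (f := fun t => T x (X t l) - t) (a := t₀)
    (fun t ht => (hTs t ht).sub (hasDerivWithinAt_id t _))
    (fun t ht => by
      rw [← heq t ht, smul_eq_mul, mul_comm, h.recip_mul (hXC t ht)]; simp) le_rfl ht
  rw [zero_mul, norm_le_zero_iff, hX0, hP.T_self x hx] at h3
  linarith

/-- The phase `ν` is that at time `t` of the solution starting ahead, so the other orbit is defined
there too. The distance splits into one at equal phase and a displacement along a single orbit, and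
equal elapsed times identify the latter with the lag at `ν`. -/
lemma dist_solutions_le {x y : Fin N → ℝ} (hx : x ∈ C) (hy : y ∈ C) {t₀ : ℝ}
    {X Y : ℝ → Fin N → ℝ} (hX0 : X t₀ = x) (hXC : ∀ t ≥ t₀, X t ∈ C)
    (hX : ∀ t ≥ t₀, HasDerivWithinAt X (V (X t)) (Ici t₀) t)
    (hY0 : Y t₀ = y) (hYC : ∀ t ≥ t₀, Y t ∈ C)
    (hY : ∀ t ≥ t₀, HasDerivWithinAt Y (V (Y t)) (Ici t₀) t) {t : ℝ} (ht : t₀ ≤ t) :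
    ∃ ν ≥ max (x l) (y l), min (x l) (y l) + c * (t - t₀) ≤ ν ∧
      ‖X t - Y t‖ ≤ ‖P x ν - P y ν‖ + L / c * L * |T x ν - T y ν| := by
  wlog hxy : y l ≤ x l generalizing x y X Y
  · obtain ⟨ν, h1, h2, h3⟩ := this hy hx hY0 hYC hY hX0 hXC hX (le_of_not_ge hxy)
    exact ⟨ν, by rwa [max_comm], by rwa [min_comm], by
      rwa [norm_sub_rev, norm_sub_rev (P x ν), abs_sub_comm (T x ν)]⟩
  obtain ⟨hX1, hX2, hX3, hX4⟩ := h.solution_eq_phaseFlow hP hx hX0 hXC hX ht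
  obtain ⟨hY1, hY2, hY3, hY4⟩ := h.solution_eq_phaseFlow hP hy hY0 hYC hY ht
  refine ⟨X t l, by simpa [hxy] using hX2, le_trans (by simp) hX1, ?_⟩
  have hyX : y l ≤ X t l := hxy.trans hX2
  have h1 := h.norm_P_sub_le hP hy hyX hY2
  have h2 := h.abs_sub_le_T hP hy hyX hY2
  rw [hY4, ← hX4] at h2
  have hLc : 0 ≤ L / c := (div_pos (h.L_pos hx) h.c_pos).le
  calc ‖X t - Y t‖ = ‖(P x (X t l) - P y (X t l)) + (P y (X t l) - P y (Y t l))‖ := by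
        rw [sub_add_sub_cancel, ← hX3, ← hY3]
    _ ≤ ‖P x (X t l) - P y (X t l)‖ + ‖P y (X t l) - P y (Y t l)‖ := norm_add_le _ _
    _ ≤ ‖P x (X t l) - P y (X t l)‖ + L / c * (L * |T y (X t l) - T x (X t l)|) := by
        gcongr
        exact h1.trans (mul_le_mul_of_nonneg_left h2 hLc)
    _ = _ := by rw [abs_sub_comm, mul_assoc]

/-- Solutions are uniformly Lipschitz in their initial values, for all times. -/
lemma stability : ∃ M > (0 : ℝ), ∀ x ∈ C, ∀ y ∈ C, ∀ (t₀ : ℝ) (X Y : ℝ → Fin N → ℝ),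
    X t₀ = x → (∀ t ≥ t₀, X t ∈ C) →
    (∀ t ≥ t₀, HasDerivWithinAt X (V (X t)) (Ici t₀) t) → Y t₀ = y → (∀ t ≥ t₀, Y t ∈ C) →
    (∀ t ≥ t₀, HasDerivWithinAt Y (V (Y t)) (Ici t₀) t) → ∀ t ≥ t₀,
    ‖X t - Y t‖ ≤ M * ‖x - y‖ := by
  let A := 1 + 2 * (L / c)
  let B := 2 * c⁻¹ + C₁ * K₀ / β * A
  -- `A` controls the distance at the first common phase, `B` the lag there plus its total later
  -- drift. The maximum with `1` keeps the constant positive even if `C` is empty.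
  refine ⟨max 1 (K₀ * A + L / c * L * B), by positivity, ?_⟩
  intro x hx y hy t₀ X Y hX0 hXC hX hY0 hYC hY t ht
  obtain ⟨ν, hν, -, hle⟩ := h.dist_solutions_le hP hx hy hX0 hXC hX hY0 hYC hY ht
  have hLc : 0 ≤ L / c := (div_pos (h.L_pos hx) h.c_pos).le
  have hL := (h.L_pos hx).le
  have hβ := h.β_pos
  have hK := h.K₀_nonneg
  have hC₁ := h.C₁_nonneg
  have hxa := le_max_left (x l) (y l)
  have hya := le_max_right (x l) (y l)
  have hsec := h.norm_P_section_le hP hx hy rfl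
  have h1 : ‖P x ν - P y ν‖ ≤ K₀ * (A * ‖x - y‖) := by
    refine (h.norm_P_sub_P_le hP hx hy hxa hya hν).trans ?_
    rw [mul_assoc]
    refine mul_le_mul_of_nonneg_left ?_ hK
    refine (mul_le_of_le_one_left (norm_nonneg _) 
      (Real.exp_le_one_iff.2 (by nlinarith))).trans hsec
  have h2 : |T x ν - T y ν| ≤ B * ‖x - y‖ := by
    have h3 := h.abs_T_increment_le hP hx hy hxa hya le_rfl hν
    have h4 := h.abs_T_section_le hP hx hy rfl
    rw [sub_self, mul_zero, Real.exp_zero, mul_one] at h3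
    have h5 := h3.trans (mul_le_mul_of_nonneg_left hsec (by positivity))
    have h6 := abs_sub_abs_le_abs_sub (T x ν - T y ν)
      (T x (max (x l) (y l)) - T y (max (x l) (y l)))
    have e : B * ‖x - y‖ = 2 * c⁻¹ * ‖x - y‖ + C₁ * K₀ / β * ((1 + 2 * (L / c)) * ‖x - y‖) := by
      simp only [B, A]; ring
    linarith
  calc ‖X t - Y t‖ ≤ K₀ * (A * ‖x - y‖) + L / c * L * (B * ‖x - y‖) :=
        hle.trans (add_le_add h1 (mul_le_mul_of_nonneg_left h2 (by positivity)))
    _ = (K₀ * A + L / c * L * B) * ‖x - y‖ := by ring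
    _ ≤ _ := mul_le_mul_of_nonneg_right (le_max_right _ _) (norm_nonneg _)

/-- Solutions with the same asymptotic time lag converge to each other exponentially. -/
lemma exponential_stability : ∃ K > (0 : ℝ), ∀ x ∈ C, ∀ y ∈ C, ‖x - y‖ ≤ 1 → ∀ b : ℝ,
    Tendsto (fun n : ℕ => T x (b + n) - T y (b + n)) atTop (𝓝 0) →
    ∀ (t₀ : ℝ) (X Y : ℝ → Fin N → ℝ), X t₀ = x → (∀ t ≥ t₀, X t ∈ C) →
    (∀ t ≥ t₀, HasDerivWithinAt X (V (X t)) (Ici t₀) t) → Y t₀ = y → (∀ t ≥ t₀, Y t ∈ C) →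
    (∀ t ≥ t₀, HasDerivWithinAt Y (V (Y t)) (Ici t₀) t) → ∀ t ≥ t₀,
    ‖X t - Y t‖ ≤ K * Real.exp (-(β * c) * (t - t₀)) * ‖x - y‖ := by
  let A := 1 + 2 * (L / c)
  let B := C₁ * K₀ / β
  refine ⟨max 1 ((K₀ + L / c * L * B) * A * Real.exp β), by positivity, ?_⟩
  intro x hx y hy hxy1 b hlim t₀ X Y hX0 hXC hX hY0 hYC hY t ht
  obtain ⟨ν, hν, hνt, hle⟩ := h.dist_solutions_le hP hx hy hX0 hXC hX hY0 hYC hY ht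
  have hLc : 0 ≤ L / c := (div_pos (h.L_pos hx) h.c_pos).le
  have hL := (h.L_pos hx).le
  have hβ := h.β_pos
  have hK := h.K₀_nonneg
  have hC₁ := h.C₁_nonneg
  have hB : 0 ≤ B := by positivity
  have hxa := le_max_left (x l) (y l)
  have hya := le_max_right (x l) (y l)
  have hsec := h.norm_P_section_le hP hx hy rfl
  have hx1 := norm_le_pi_norm (x - y) l
  rw [Pi.sub_apply, Real.norm_eq_abs] at hx1
  -- The factor `exp β` pays for initial phases that differ by at most `1`.
  have hexp : Real.exp (-β * (ν - max (x l) (y l))) ≤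
      Real.exp β * Real.exp (-(β * c) * (t - t₀)) := by
    rw [← Real.exp_add]
    refine Real.exp_le_exp.2 ?_
    have : max (x l) (y l) - min (x l) (y l) ≤ 1 := by
      rw [max_sub_min_eq_abs']; exact hx1.trans hxy1
    nlinarith
  set e := Real.exp (-β * (ν - max (x l) (y l))) with he
  have h1 : ‖P x ν - P y ν‖ ≤ K₀ * e * (A * ‖x - y‖) :=
    (h.norm_P_sub_P_le hP hx hy hxa hya hν).trans
      (mul_le_mul_of_nonneg_left hsec (by positivity))
  -- As the lag tends to zero, its present size equals that of its remaining increment, which is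
  -- exponentially small.
  have h2 : |T x ν - T y ν| ≤ B * e * (A * ‖x - y‖) := by
    have hlim' : Tendsto (fun n : ℕ => |(T x (b + n) - T y (b + n)) - (T x ν - T y ν)|) atTop
        (𝓝 |0 - (T x ν - T y ν)|) := (hlim.sub_const _).abs
    rw [zero_sub, abs_neg] at hlim'
    refine le_of_tendsto hlim' ?_
    have hbig : ∀ᶠ n : ℕ in atTop, ν ≤ b + n := by
      filter_upwards [tendsto_natCast_atTop_atTop.eventually_ge_atTop (ν - b)] with n hn
      linarith
    filter_upwards [hbig] with n hn
    exact (h.abs_T_increment_le hP hx hy hxa hya hν hn).trans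
      (mul_le_mul_of_nonneg_left hsec (by positivity))
  calc ‖X t - Y t‖ ≤ K₀ * e * (A * ‖x - y‖) + L / c * L * (B * e * (A * ‖x - y‖)) :=
        hle.trans (add_le_add h1 (mul_le_mul_of_nonneg_left h2 (by positivity)))
    _ = (K₀ + L / c * L * B) * A * e * ‖x - y‖ := by ring
    _ ≤ (K₀ + L / c * L * B) * A * (Real.exp β * Real.exp (-(β * c) * (t - t₀))) * ‖x - y‖ :=
        mul_le_mul_of_nonneg_right (mul_le_mul_of_nonneg_left hexp
          (by simp only [A]; positivity)) (norm_nonneg _)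
    _ = (K₀ + L / c * L * B) * A * Real.exp β * Real.exp (-(β * c) * (t - t₀)) * ‖x - y‖ := by
        ring
    _ ≤ _ := by
        gcongr
        exact le_max_right _ _

/-- Restarting the phase flow at a later point of the orbit. -/
lemma T_restart {x : Fin N → ℝ} (hx : x ∈ C) {ν₀ ν : ℝ} (h0 : x l ≤ ν₀) (h1 : ν₀ ≤ ν) :
    T (P x ν₀) ν = T x ν - T x ν₀ := by
  have hy := hP.mem x hx ν₀ h0
  have hyl := hP.phase x hx ν₀ h0
  have hsol := hP.hasDeriv_P _ hy
  have hsolT := hP.hasDeriv_T _ hy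
  have hself := hP.P_self _ hy
  have hselfT := hP.T_self _ hy
  rw [hyl] at hsol hsolT hself hselfT
  have heq : ∀ ν ≥ ν₀, P (P x ν₀) ν = P x ν := fun ν hν =>
    solution_unique_autonomous h.contDiff_rescaled
      (fun s hs => (hsol s hs.1).mono Icc_subset_Ici_self)
      (fun s hs => (hP.hasDeriv_P x hx s (h0.trans hs.1)).mono
        (Icc_subset_Ici_self.trans (Ici_subset_Ici.2 h0))) hself ⟨hν, le_rfl⟩
  have h3 := norm_sub_le_of_hasDerivWithinAt_Ici (M := 0)
    (f := fun t => T (P x ν₀) t - T x t) (a := ν₀)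
    (fun t ht => (hsolT t ht).sub
      ((hP.hasDeriv_T x hx t (h0.trans ht)).mono (Ici_subset_Ici.2 h0)))
    (fun t ht => by rw [heq t ht]; simp) le_rfl h1
  rw [zero_mul, norm_le_zero_iff, hselfT] at h3
  linarith

/-! ### Smooth hitting times and the asymptotic lag. -/

/-- The time to reach a given phase is a `C¹` function of the initial point. -/
lemma contDiffOn_T (ν : ℝ) : ContDiffOn ℝ 1 (fun x => T x ν) {x | x ∈ C ∧ x l < ν} := by
  -- The last coordinate is a constant parameter scaling the speed. With the value `ν - x l` the
  -- phase `ν` is reached at parameter time one, so the hitting time is a component of a time-one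
  -- map.
  let W : (Fin N → ℝ) × ℝ × ℝ → (Fin N → ℝ) × ℝ × ℝ :=
    fun p => (p.2.2 • (k p.1 • V p.1), p.2.2 * k p.1, 0)
  have hW : ContDiff ℝ 1 W :=
    (contDiff_snd.snd.smul (h.contDiff_rescaled.comp contDiff_fst)).prodMk
      ((contDiff_snd.snd.mul (h.contDiff_recip.comp contDiff_fst)).prodMk contDiff_const)
  let Ω : Set ((Fin N → ℝ) × ℝ × ℝ) := {p | p.1 ∈ C ∧ 0 < p.2.2}
  have hΩ : IsOpen Ω := (h.isOpen.preimage continuous_fst).inter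
    (isOpen_lt continuous_const continuous_snd.snd)
  let Φ : (Fin N → ℝ) × ℝ × ℝ → ℝ → (Fin N → ℝ) × ℝ × ℝ := fun p t =>
    (P p.1 (p.1 l + p.2.2 * t), p.2.1 + T p.1 (p.1 l + p.2.2 * t), p.2.2)
  have hphase : ∀ p ∈ Ω, ∀ t ∈ Icc (0 : ℝ) 1, p.1 l ≤ p.1 l + p.2.2 * t := fun p hp t ht =>
    le_add_of_nonneg_right (mul_nonneg (le_of_lt hp.2) ht.1)
  have hmain := contDiffOn_time_one_map hW hΩ (Φ := Φ)
    (fun p hp => by simp [Φ, hP.P_self _ hp.1, hP.T_self _ hp.1])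
    (fun p hp t ht => by
      have h1 : HasDerivWithinAt (fun t => p.1 l + p.2.2 * t) p.2.2 (Icc 0 1) t := by
        simpa using ((hasDerivWithinAt_id t (Icc (0 : ℝ) 1)).const_mul p.2.2).const_add (p.1 l)
      have h2 := (hP.hasDeriv_P _ hp.1 _ (hphase p hp t ht)).scomp t h1 (hphase p hp)
      have h3 := (hP.hasDeriv_T _ hp.1 _ (hphase p hp t ht)).scomp t h1 (hphase p hp)
      exact h2.prodMk ((h3.const_add p.2.1).prodMk (hasDerivWithinAt_const t _ _)))
    (fun p hp => by
      refine ⟨‖p‖ + 1 + (L / c + c⁻¹) * (‖p‖ + 1), ?_⟩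
      have hLc : 0 < L / c := div_pos (h.L_pos hp.1) h.c_pos
      have hc := inv_pos.2 h.c_pos
      filter_upwards [hΩ.mem_nhds hp, ball_mem_nhds p one_pos] with q hq hqp t ht
      have hqn : ‖q‖ ≤ ‖p‖ + 1 := by
        rw [mem_ball, dist_eq_norm] at hqp
        have : ‖q‖ ≤ ‖q - p‖ + ‖p‖ := by simpa using norm_add_le (q - p) p
        linarith
      have hq1 : ‖q.1‖ ≤ ‖q‖ := norm_fst_le q
      have hq21 : ‖q.2.1‖ ≤ ‖q‖ := (norm_fst_le q.2).trans (norm_snd_le q)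
      have hq22 : ‖q.2.2‖ ≤ ‖q‖ := (norm_snd_le q.2).trans (norm_snd_le q)
      have hst : |q.1 l + q.2.2 * t - q.1 l| ≤ ‖p‖ + 1 := by
        rw [add_sub_cancel_left, abs_mul, abs_of_nonneg ht.1]
        exact (mul_le_of_le_one_right (abs_nonneg _) ht.2).trans (hq22.trans hqn)
      have h1 := h.norm_P_sub_le hP hq.1 (hphase q hq t ht) le_rfl
      have h2 := h.abs_T_sub_le hP hq.1 (hphase q hq t ht) le_rfl
      rw [hP.P_self _ hq.1] at h1
      rw [hP.T_self _ hq.1, sub_zero] at h2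
      have h1' := h1.trans (mul_le_mul_of_nonneg_left hst hLc.le)
      have h2' := h2.trans (mul_le_mul_of_nonneg_left hst hc.le)
      have h3 : ‖P q.1 (q.1 l + q.2.2 * t)‖ ≤ ‖P q.1 (q.1 l + q.2.2 * t) - q.1‖ + ‖q.1‖ := by
        simpa using norm_add_le (P q.1 (q.1 l + q.2.2 * t) - q.1) q.1
      have h4 : ‖q.2.1 + T q.1 (q.1 l + q.2.2 * t)‖ ≤ ‖q.2.1‖ + |T q.1 (q.1 l + q.2.2 * t)| :=
        norm_add_le _ _
      have hp0 := norm_nonneg p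
      have e1 : 0 ≤ L / c * (‖p‖ + 1) := by positivity
      have e2 : 0 ≤ c⁻¹ * (‖p‖ + 1) := by positivity
      have e3 : (L / c + c⁻¹) * (‖p‖ + 1) = L / c * (‖p‖ + 1) + c⁻¹ * (‖p‖ + 1) := by ring
      refine norm_prod_le_iff.2 ⟨?_, norm_prod_le_iff.2 ⟨?_, ?_⟩⟩
      · change ‖P q.1 (q.1 l + q.2.2 * t)‖ ≤ _
        linarith
      · change ‖q.2.1 + T q.1 (q.1 l + q.2.2 * t)‖ ≤ _
        linarith
      · change ‖q.2.2‖ ≤ _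
        linarith)
  have hι : ContDiff ℝ 1 (fun x : Fin N → ℝ => ((x, 0, ν - x l) : (Fin N → ℝ) × ℝ × ℝ)) :=
    contDiff_id.prodMk (contDiff_const.prodMk (contDiff_const.sub (contDiff_apply ℝ ℝ l)))
  have := (hmain.snd.fst).comp hι.contDiffOn (s := {x | x ∈ C ∧ x l < ν})
    (fun x hx => ⟨hx.1, sub_pos.2 hx.2⟩)
  refine this.congr fun x hx => ?_
  simp [Φ]

/-- The asymptotic time lag with respect to the orbit of `x` is a `C¹` function near `x`, and its
derivative does not vanish. -/
lemma exists_asymptotic_lag {x : Fin N → ℝ} (hx : x ∈ C) :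
    ∃ ρ > (0 : ℝ), ρ ≤ 1 ∧ ball x ρ ⊆ C ∧ ∃ θ : (Fin N → ℝ) → ℝ, ContDiffOn ℝ 1 θ (ball x ρ) ∧
      fderiv ℝ θ x ≠ 0 ∧ θ x = 0 ∧ ∀ y ∈ ball x ρ, ∃ b : ℝ,
        Tendsto (fun n : ℕ => T y (b + n) - T x (b + n)) atTop (𝓝 (θ y)) := by
  obtain ⟨ρ₀, hρ₀, hball⟩ := Metric.isOpen_iff.1 h.isOpen x hx
  let ρ := min ρ₀ 1
  have hρ : 0 < ρ := lt_min hρ₀ one_pos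
  have hρC : ball x ρ ⊆ C := (ball_subset_ball (min_le_left _ _)).trans hball
  -- As `ρ ≤ 1`, every point of the ball has phase below `b`, so all lags from `b` on are defined.
  let b := x l + 1
  have hlt : ∀ y ∈ ball x ρ, y l < b := fun y hy => by
    rw [mem_ball, dist_eq_norm] at hy
    have h1 := (norm_le_pi_norm (y - x) l).trans_lt (hy.trans_le (min_le_right _ _))
    rw [Pi.sub_apply, Real.norm_eq_abs] at h1
    linarith [le_abs_self (y l - x l)]
  have hbn : ∀ (n : ℕ), ∀ y ∈ ball x ρ, y l < b + n := fun n y hy =>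
    (hlt y hy).trans_le (le_add_of_nonneg_right n.cast_nonneg)
  have hTC : ∀ n : ℕ, ContDiffOn ℝ 1 (fun y => T y (b + n)) (ball x ρ) := fun n =>
    (h.contDiffOn_T hP (b + n)).mono fun y hy => ⟨hρC hy, hbn n y hy⟩
  have hxb : x ∈ ball x ρ := mem_ball_self hρ
  let inc : ℕ → (Fin N → ℝ) → ℝ := fun n y =>
    (T y (b + (n + 1 : ℕ)) - T x (b + (n + 1 : ℕ))) - (T y (b + n) - T x (b + n))
  have hincC : ∀ n, ContDiffOn ℝ 1 (inc n) (ball x ρ) := fun n =>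
    ((hTC (n + 1)).sub contDiffOn_const).sub ((hTC n).sub contDiffOn_const)
  have hincd : ∀ n, ∀ y ∈ ball x ρ, HasFDerivAt (inc n) (fderiv ℝ (inc n) y) y := fun n y hy =>
    (((hincC n).differentiableOn (by simp)).differentiableAt (isOpen_ball.mem_nhds hy)).hasFDerivAt
  have hβ := h.β_pos
  have hK := h.K₀_nonneg
  have hC₁ := h.C₁_nonneg
  have hLc : 0 < L / c := div_pos (h.L_pos hx) h.c_pos
  let Q := C₁ * K₀ / β * (1 + 2 * (L / c))
  have hQ : 0 ≤ Q := by positivity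
  let u : ℕ → ℝ := fun n => Q * Real.exp (-β) ^ n
  have hu : Summable u :=
    (summable_geometric_of_lt_one (Real.exp_pos _).le
      (Real.exp_lt_one_iff.2 (by linarith))).mul_left _
  -- The increments are Lipschitz with geometrically decaying constants, hence so are the bounds on
  -- their derivatives; the telescoping series can be differentiated termwise.
  have hincb : ∀ n, ∀ y ∈ ball x ρ, ‖fderiv ℝ (inc n) y‖ ≤ u n := by
    intro n y hy
    refine (hincd n y hy).le_of_lip' (by positivity) ?_
    filter_upwards [isOpen_ball.mem_nhds hy] with z hz
    have ha : max (z l) (y l) ≤ b := max_le (hlt z hz).le (hlt y hy).le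
    have h1 := h.abs_T_increment_le hP (hρC hz) (hρC hy) (le_max_left _ _) (le_max_right _ _)
      (ha.trans (le_add_of_nonneg_right n.cast_nonneg))
      (by push_cast; linarith : b + n ≤ b + (n + 1 : ℕ))
    have h2 := h.norm_P_section_le hP (hρC hz) (hρC hy) rfl
    have hexp : Real.exp (-β * (b + n - max (z l) (y l))) ≤ Real.exp (-β) ^ n := by
      rw [← Real.exp_nat_mul]
      refine Real.exp_le_exp.2 ?_
      nlinarith
    calc ‖inc n z - inc n y‖ = |T z (b + (n + 1 : ℕ)) - T y (b + (n + 1 : ℕ)) -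
          (T z (b + n) - T y (b + n))| := by
          rw [Real.norm_eq_abs]; congr 1; simp only [inc]; ring
      _ ≤ C₁ * K₀ / β * Real.exp (-β) ^ n * ((1 + 2 * (L / c)) * ‖z - y‖) :=
          h1.trans (mul_le_mul (mul_le_mul_of_nonneg_left hexp (by positivity)) h2
            (norm_nonneg _) (by positivity))
      _ = u n * ‖z - y‖ := by simp only [u, Q]; ring
  have hinc0 : Summable fun n => inc n x := by
    have : (fun n => inc n x) = 0 := by ext n; simp [inc]
    rw [this]; exact summable_zero
  have hpre : IsPreconnected (ball x ρ) := (convex_ball x ρ).isPreconnected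
  have hsumd : ∀ y ∈ ball x ρ,
      HasFDerivAt (fun y => ∑' n, inc n y) (∑' n, fderiv ℝ (inc n) y) y := fun y hy =>
    hasFDerivAt_tsum_of_isPreconnected hu isOpen_ball hpre hincd hincb hxb hinc0 hy
  have hsumC : ContDiffOn ℝ 1 (fun y => ∑' n, inc n y) (ball x ρ) := by
    rw [← zero_add 1, contDiffOn_succ_iff_fderiv_of_isOpen isOpen_ball]
    refine ⟨fun y hy => (hsumd y hy).differentiableAt.differentiableWithinAt, by simp,
      contDiffOn_zero.2 ?_⟩
    refine ContinuousOn.congr (f := fun y => ∑' n, fderiv ℝ (inc n) y) ?_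
      fun y hy => (hsumd y hy).fderiv
    exact continuousOn_tsum (fun n => (hincC n).continuousOn_fderiv_of_isOpen isOpen_ball le_rfl)
      hu hincb
  let θ : (Fin N → ℝ) → ℝ := fun y => (T y (b + (0 : ℕ)) - T x (b + (0 : ℕ))) + ∑' n, inc n y
  have hθC : ContDiffOn ℝ 1 θ (ball x ρ) := ((hTC 0).sub contDiffOn_const).add hsumC
  have hlim : ∀ y ∈ ball x ρ, Tendsto (fun n : ℕ => T y (b + n) - T x (b + n)) atTop (𝓝 (θ y)) := by
    intro y hy
    have hs := (summable_of_summable_hasFDerivAt_of_isPreconnected hu isOpen_ball hpre hincd hincb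
      hxb hinc0 hy).hasSum.tendsto_sum_nat
    refine (hs.const_add (T y (b + (0 : ℕ)) - T x (b + (0 : ℕ)))).congr fun n => ?_
    rw [Finset.sum_range_sub (fun n : ℕ => T y (b + n) - T x (b + n)) n]
    ring
  have hθx : θ x = 0 := tendsto_nhds_unique (hlim x hxb) (by simp)
  refine ⟨ρ, hρ, min_le_right _ _, hρC, θ, hθC, fun hzero => ?_, hθx, fun y hy => ⟨b, hlim y hy⟩⟩
  have hθd : HasFDerivAt θ (0 : (Fin N → ℝ) →L[ℝ] ℝ) x := by
    rw [← hzero]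
    exact ((hθC.differentiableOn (by simp)).differentiableAt
      (isOpen_ball.mem_nhds hxb)).hasFDerivAt
  have hPd := hP.hasDeriv_P x hx (x l) le_rfl
  have hTd := hP.hasDeriv_T x hx (x l) le_rfl
  rw [hP.P_self x hx] at hPd hTd
  have hcomp : HasDerivWithinAt (fun ν => θ (P x ν)) 0 (Ici (x l)) (x l) := by
    rw [← hP.P_self x hx] at hθd
    exact hθd.comp_hasDerivWithinAt (x l) hPd
  -- On the orbit of `x` itself the lag is minus the elapsed time. Its derivative is `-k x ≠ 0`,
  -- which excludes a vanishing differential.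
  have hev : ∀ᶠ ν in 𝓝[≥] (x l), θ (P x ν) = -T x ν := by
    have hnear : ∀ᶠ ν in 𝓝[≥] (x l), P x ν ∈ ball x ρ := by
      have := hPd.continuousWithinAt
      refine this.eventually (isOpen_ball.mem_nhds ?_)
      rwa [hP.P_self x hx]
    filter_upwards [hnear, self_mem_nhdsWithin] with ν hν hν0
    refine tendsto_nhds_unique (hlim _ hν) (tendsto_const_nhds.congr fun n => ?_)
    have hνb := hbn n _ hν
    rw [hP.phase x hx ν hν0] at hνb
    rw [h.T_restart hP hx hν0 hνb.le]
    ring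
  have hneg : HasDerivWithinAt (fun ν => -T x ν) 0 (Ici (x l)) (x l) :=
    hcomp.congr_of_eventuallyEq (hev.mono fun ν hν => hν.symm)
      (by rw [hP.P_self x hx, hθx, hP.T_self x hx, neg_zero])
  have := (uniqueDiffWithinAt_Ici (x l)).eq_deriv _ hneg hTd.neg
  linarith [h.recip_pos hx]

end PhaseContraction

/-! ### Level sets and stable hypersurfaces. -/

/-- A regular level set of a `C¹` function is a hypersurface. -/
lemma isC1Submanifold_of_fderiv_ne_zero {N : ℕ} {O : Set (Fin N → ℝ)} (hO : IsOpen O)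
    {θ : (Fin N → ℝ) → ℝ} (hθ : ContDiffOn ℝ 1 θ O) {x : Fin N → ℝ} (hx : x ∈ O)
    (hne : fderiv ℝ θ x ≠ 0) :
    ∃ O' ⊆ O, x ∈ O' ∧ IsC1Submanifold (N - 1) {y | y ∈ O' ∧ θ y = 0} := by
  obtain ⟨j, hj⟩ : ∃ j, fderiv ℝ θ x (Pi.single j 1) ≠ 0 := by
    by_contra! hcon
    refine hne (ContinuousLinearMap.ext fun v => ?_)
    rw [← Finset.univ_sum_single v, map_sum]
    refine Finset.sum_eq_zero fun i _ => ?_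
    have : Pi.single i (v i) = v i • (Pi.single i 1 : Fin N → ℝ) := by
      rw [← Pi.single_smul, smul_eq_mul, mul_one]
    rw [this, map_smul, hcon i, smul_zero]
  have hN : 0 < N := Fin.pos j
  let l : Fin N := ⟨N - 1, by omega⟩
  let σ := Equiv.swap j l
  -- The chart replaces the coordinate `j`, along which `θ` has nonzero derivative, by `θ`, and the
  -- swap moves it to the last place.
  let f : (Fin N → ℝ) → Fin N → ℝ := fun y i => if i = l then θ y else y (σ i)
  let f' : (Fin N → ℝ) → (Fin N → ℝ) →L[ℝ] (Fin N → ℝ) := fun y =>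
    ContinuousLinearMap.pi fun i =>
      if i = l then fderiv ℝ θ y else ContinuousLinearMap.proj (σ i)
  have hf : ContDiffOn ℝ 1 f O := by
    refine contDiffOn_pi.2 fun i => ?_
    by_cases hi : i = l
    · simpa [f, hi] using hθ
    · simp only [f, hi, if_false]
      exact (contDiff_apply ℝ ℝ (σ i)).contDiffOn
  have hfd : ∀ y ∈ O, HasFDerivAt f (f' y) y := by
    intro y hy
    refine hasFDerivAt_pi.2 fun i => ?_
    by_cases hi : i = l
    · simpa [f, hi] using
        ((hθ.differentiableOn (by simp)).differentiableAt (hO.mem_nhds hy)).hasFDerivAt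
    · simp only [hi, if_false]
      exact (ContinuousLinearMap.proj (σ i) : (Fin N → ℝ) →L[ℝ] ℝ).hasFDerivAt
  have hinj : Function.Injective (f' x : (Fin N → ℝ) →ₗ[ℝ] (Fin N → ℝ)) := by
    rw [← LinearMap.ker_eq_bot, LinearMap.ker_eq_bot']
    intro v hv
    have hv' : ∀ i, f' x v i = 0 := fun i => congrFun hv i
    have hvi : ∀ i, i ≠ j → v i = 0 := by
      intro i hij
      have h1 := hv' (σ.symm i)
      have h2 : σ.symm i ≠ l := by
        intro h3
        rw [Equiv.symm_apply_eq] at h3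
        exact hij (by rw [h3]; simp [σ])
      simpa [f', h2] using h1
    have hvs : v = v j • Pi.single j 1 := by
      ext i
      by_cases hij : i = j
      · subst hij; simp
      · simp [hvi i hij, hij]
    have h4 : fderiv ℝ θ x v = 0 := by simpa [f'] using hv' l
    rw [hvs, map_smul, smul_eq_mul] at h4
    rw [hvs, (mul_eq_zero.1 h4).resolve_right hj, zero_smul]
  let e : (Fin N → ℝ) ≃L[ℝ] (Fin N → ℝ) :=
    (LinearEquiv.ofInjectiveEndo _ hinj).toContinuousLinearEquiv
  have he : (e : (Fin N → ℝ) →L[ℝ] (Fin N → ℝ)) = f' x := by ext v; rfl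
  have hfx : ContDiffAt ℝ 1 f x := hf.contDiffAt (hO.mem_nhds hx)
  let φ₀ := hfx.toOpenPartialHomeomorph f (f' := e) (by rw [he]; exact hfd x hx) (by simp)
  -- The chart domain is shrunk to where the derivative is invertible, so that the inverse is `C¹`
  -- on the whole target and not only at one point.
  let I : Set ((Fin N → ℝ) →L[ℝ] (Fin N → ℝ)) :=
    range ((↑) : ((Fin N → ℝ) ≃L[ℝ] (Fin N → ℝ)) → _)
  let U := O ∩ fderiv ℝ f ⁻¹' I
  have hU : IsOpen U := (hf.continuousOn_fderiv_of_isOpen hO le_rfl).isOpen_inter_preimage hO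
    ContinuousLinearEquiv.isOpen
  let φ := φ₀.restrOpen U hU
  have hφs : φ.source = φ₀.source ∩ U := φ₀.restrOpen_source U hU
  have hφf : ∀ y, φ y = f y := fun y => rfl
  have hxφ : x ∈ φ.source := by
    rw [hφs]
    exact ⟨hfx.mem_toOpenPartialHomeomorph_source _ _, hx, e, by rw [he, (hfd x hx).fderiv]⟩
  have hsub : φ.source ⊆ O := fun y hy => by rw [hφs] at hy; exact hy.2.1
  refine ⟨φ.source, hsub, hxφ, fun p hp => ⟨φ, hp.1, hf.mono hsub, fun y hy => ?_, fun y hy => ?_⟩⟩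
  · have hyS := φ.map_target hy
    have hyU : φ.symm y ∈ U := by rw [hφs] at hyS; exact hyS.2
    obtain ⟨e', he'⟩ := hyU.2
    refine (φ.contDiffAt_symm (f₀' := e') hy ?_ ?_).contDiffWithinAt
    · rw [he', (hfd _ hyU.1).fderiv]; exact hfd _ hyU.1
    · exact hf.contDiffAt (hO.mem_nhds hyU.1)
  · have hli : ∀ i : Fin N, N - 1 ≤ (i : ℕ) ↔ i = l := fun i => by
      rw [Fin.ext_iff]; simp only [l]; omega
    simp only [hφf, hli, forall_eq, mem_ofPred_eq, hy, true_and]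
    simp [f]

/-- Stability and exponentially stable hypersurfaces for the flow of a phase contracting field. -/
theorem PhaseContraction.exists_stable_hypersurfaces {N : ℕ} {l : Fin N} {C : Set (Fin N → ℝ)}
    {V : (Fin N → ℝ) → Fin N → ℝ} {k : (Fin N → ℝ) → ℝ} {g : ℝ → ℝ} {c L κ C₁ K₀ β : ℝ}
    (h : PhaseContraction l C V k g c L κ C₁ K₀ β) {t₀ : ℝ}
    {Φ : ℝ → (Fin N → ℝ) → Fin N → ℝ} (hΦ : IsFlowOn V t₀ C Φ)
    (hinv : ∀ X ∈ C, ∀ t ≥ t₀, Φ t X ∈ C) :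
    (∃ M > (0 : ℝ), ∀ X ∈ C, ∃ δ > (0 : ℝ), ∀ Y ∈ C, Y ≠ X → ‖X - Y‖ < δ →
      ∀ t ≥ t₀, ‖Φ t X - Φ t Y‖ < M * ‖X - Y‖) ∧
    ∃ W : (Fin N → ℝ) → Set (Fin N → ℝ),
      (∀ X ∈ C, X ∈ W X ∧ W X ⊆ C ∧ IsC1Submanifold (N - 1) (W X)) ∧
      ∃ β > (0 : ℝ), ∃ K > (0 : ℝ), ∀ X ∈ C, ∀ Y ∈ W X, Y ≠ X →
        ∀ t ≥ t₀, ‖Φ t X - Φ t Y‖ < K * Real.exp (-β * (t - t₀)) * ‖X - Y‖ := by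
  obtain ⟨P, T, hP⟩ := h.exists_isPhaseFlow
  have hpos : ∀ {X Y : Fin N → ℝ}, Y ≠ X → 0 < ‖X - Y‖ := fun hne =>
    norm_pos_iff.2 (sub_ne_zero.2 hne.symm)
  constructor
  · obtain ⟨M, hM, hst⟩ := h.stability hP
    -- The bound is uniform on `C`, so `δ = 1` is arbitrary; `M + 1` makes the inequality strict
    -- since `Y ≠ X`.
    refine ⟨M + 1, by positivity, fun X hX => ⟨1, one_pos, fun Y hY hne _ t ht => ?_⟩⟩
    refine (hst X hX Y hY t₀ (fun t => Φ t X) (fun t => Φ t Y) (hΦ X hX).1 (hinv X hX) (hΦ X hX).2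
      (hΦ Y hY).1 (hinv Y hY) (hΦ Y hY).2 t ht).trans_lt ?_
    exact mul_lt_mul_of_pos_right (lt_add_one M) (hpos hne)
  · have hW : ∀ X ∈ C, ∃ W : Set (Fin N → ℝ), X ∈ W ∧ W ⊆ C ∧ IsC1Submanifold (N - 1) W ∧
        ∀ Y ∈ W, ‖X - Y‖ ≤ 1 ∧
          ∃ b : ℝ, Tendsto (fun n : ℕ => T X (b + n) - T Y (b + n)) atTop (𝓝 0) := by
      intro X hX
      obtain ⟨ρ, hρ, hρ1, hρC, θ, hθ, hne, hθX, hlim⟩ := h.exists_asymptotic_lag hP hX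
      obtain ⟨O, hO, hXO, hsub⟩ := isC1Submanifold_of_fderiv_ne_zero isOpen_ball hθ
        (mem_ball_self hρ) hne
      refine ⟨{y | y ∈ O ∧ θ y = 0}, ⟨hXO, hθX⟩, fun Y hY => hρC (hO hY.1), hsub,
        fun Y hY => ⟨?_, ?_⟩⟩
      · have := hO hY.1
        rw [mem_ball', dist_eq_norm] at this
        exact (this.trans_le hρ1).le
      · obtain ⟨b, hb⟩ := hlim Y (hO hY.1)
        rw [hY.2] at hb
        exact ⟨b, by simpa using hb.neg⟩
    choose! W hXW hWC hWsub hWlim using hW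
    obtain ⟨K, hK, hexp⟩ := h.exponential_stability hP
    refine ⟨W, fun X hX => ⟨hXW X hX, hWC X hX, hWsub X hX⟩, β * c, mul_pos h.β_pos h.c_pos,
      K + 1, by positivity, fun X hX Y hYW hne t ht => ?_⟩
    have hY := hWC X hX hYW
    obtain ⟨h1, b, hb⟩ := hWlim X hX Y hYW
    refine (hexp X hX Y hY h1 b hb t₀ (fun t => Φ t X) (fun t => Φ t Y) (hΦ X hX).1 (hinv X hX)
      (hΦ X hX).2 (hΦ Y hY).1 (hinv Y hY) (hΦ Y hY).2 t ht).trans_lt ?_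
    exact mul_lt_mul_of_pos_right (mul_lt_mul_of_pos_right (lt_add_one K) (Real.exp_pos _))
      (hpos hne)

/-! ### Forward invariance of tubes. -/

lemma isOpen_tube (N : ℕ) (Δ : ℝ → ℝ) : IsOpen (tube N Δ) := by
  have : tube N Δ = ⋃ ν : ℝ, ⋂ i, {X | |X i - ν| < Δ ν} := by
    ext X; simp [tube]
  rw [this]
  exact isOpen_iUnion fun ν => isOpen_iInter_of_finite fun i =>
    isOpen_lt ((continuous_apply i).sub continuous_const).abs continuous_const

/-- A tube is forward invariant for all positive multiples of a field that points inwards along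
its boundary. -/
lemma exists_solution_mem_tube {N : ℕ} {V : (Fin N → ℝ) → Fin N → ℝ} (hV : ContDiff ℝ 1 V)
    {F : (Fin N → ℝ) → ℝ → ℝ} (hF : ContDiff ℝ 1 (fun p : (Fin N → ℝ) × ℝ => F p.1 p.2))
    {k : (Fin N → ℝ) → ℝ} (hk : ContDiff ℝ 1 k) (hk0 : ∀ x, 0 < k x) {B : ℝ}
    (hkB : ∀ x, k x ≤ B) {Δ : ℝ → ℝ} (hΔ : ContDiff ℝ 1 Δ) (hΔ0 : ∀ ν, 0 < Δ ν) {L : ℝ}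
    (hL : ∀ x ν, (∀ j, |x j - ν| < Δ ν) → ‖V x‖ ≤ L ∧ |F x ν| ≤ L)
    (hin : ∀ x ν i, (∀ j, |x j - ν| ≤ Δ ν) → |x i - ν| = Δ ν →
      0 < Δ ν * deriv Δ ν * F x ν - (x i - ν) * (V x i - F x ν))
    {x : Fin N → ℝ} (hx : x ∈ tube N Δ) :
    ∃ z : ℝ → (Fin N → ℝ) × ℝ, z 0 = (x, 0) ∧ ∀ s ≥ 0, (z s).1 ∈ tube N Δ ∧
      HasDerivWithinAt z (k (z s).1 • V (z s).1, k (z s).1) (Ici 0) s := by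
  obtain ⟨ν₀, hν₀⟩ := hx
  -- The coordinates are the point, the elapsed time and a moving centre `ν` driven by `F(X, ν)`.
  -- The tube is the projection of the region where all `b i` below are positive.
  let W : (Fin N → ℝ) × ℝ × ℝ → (Fin N → ℝ) × ℝ × ℝ :=
    fun p => (k p.1 • V p.1, k p.1, k p.1 * F p.1 p.2.2)
  have hk' : ContDiff ℝ 1 (fun p : (Fin N → ℝ) × ℝ × ℝ => k p.1) := hk.comp contDiff_fst
  have hW : ContDiff ℝ 1 W := (hk'.smul (hV.comp contDiff_fst)).prodMk
    (hk'.prodMk (hk'.mul (hF.comp (contDiff_fst.prodMk contDiff_snd.snd))))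
  let b : Fin N → (Fin N → ℝ) × ℝ × ℝ → ℝ := fun i p => Δ p.2.2 ^ 2 - (p.1 i - p.2.2) ^ 2
  have hpos : ∀ i p, 0 < b i p ↔ |p.1 i - p.2.2| < Δ p.2.2 := fun i p => by
    simp only [b]
    rw [sub_pos, sq_lt_sq, abs_of_pos (hΔ0 _)]
  have hnonneg : ∀ i p, 0 ≤ b i p ↔ |p.1 i - p.2.2| ≤ Δ p.2.2 := fun i p => by
    simp only [b]
    rw [sub_nonneg, sq_le_sq, abs_of_pos (hΔ0 _)]
  have hbd : ∀ i p, HasFDerivAt (b i) ((2 * Δ p.2.2 * deriv Δ p.2.2) •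
      ((ContinuousLinearMap.snd ℝ ℝ ℝ).comp (ContinuousLinearMap.snd ℝ (Fin N → ℝ) (ℝ × ℝ))) -
      (2 * (p.1 i - p.2.2)) • (((ContinuousLinearMap.proj i).comp
        (ContinuousLinearMap.fst ℝ (Fin N → ℝ) (ℝ × ℝ))) -
        ((ContinuousLinearMap.snd ℝ ℝ ℝ).comp (ContinuousLinearMap.snd ℝ (Fin N → ℝ) (ℝ × ℝ)))))
      p := by
    intro i p
    have h1 : HasFDerivAt (fun p : (Fin N → ℝ) × ℝ × ℝ => p.2.2)
        ((ContinuousLinearMap.snd ℝ ℝ ℝ).comp (ContinuousLinearMap.snd ℝ (Fin N → ℝ) (ℝ × ℝ))) p :=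
      ((ContinuousLinearMap.snd ℝ ℝ ℝ).comp
        (ContinuousLinearMap.snd ℝ (Fin N → ℝ) (ℝ × ℝ))).hasFDerivAt
    have h2 : HasFDerivAt (fun p : (Fin N → ℝ) × ℝ × ℝ => p.1 i)
        ((ContinuousLinearMap.proj i).comp (ContinuousLinearMap.fst ℝ (Fin N → ℝ) (ℝ × ℝ))) p :=
      ((ContinuousLinearMap.proj i : (Fin N → ℝ) →L[ℝ] ℝ).comp
        (ContinuousLinearMap.fst ℝ (Fin N → ℝ) (ℝ × ℝ))).hasFDerivAt
    have h3 := ((hΔ.differentiable (by simp) p.2.2).hasDerivAt.comp_hasFDerivAt p h1).pow 2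
    have h4 := (h2.sub h1).pow 2
    refine (h3.sub h4).congr_fderiv ?_
    ext v <;> simp
  obtain ⟨z, hz0, hz, hzb⟩ := exists_solution_mem_of_barrier hW (h := b)
    (fun i p => (hbd i p).differentiableAt) (L := B * L + B) (fun p hp => by
      have hB : 0 ≤ B := (hk0 p.1).le.trans (hkB p.1)
      obtain ⟨h1, h2⟩ := hL p.1 p.2.2 fun j => (hpos j p).1 (hp j)
      have hL0 : 0 ≤ L := (norm_nonneg _).trans h1
      have hBL : 0 ≤ B * L := mul_nonneg hB hL0
      have hkn : ‖k p.1‖ ≤ B := by rw [Real.norm_eq_abs, abs_of_pos (hk0 _)]; exact hkB _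
      refine norm_prod_le_iff.2 ⟨?_, norm_prod_le_iff.2 ⟨?_, ?_⟩⟩
      · change ‖k p.1 • V p.1‖ ≤ _
        rw [norm_smul]
        exact (mul_le_mul hkn h1 (norm_nonneg _) hB).trans (by linarith)
      · change ‖k p.1‖ ≤ _
        linarith
      · change ‖k p.1 * F p.1 p.2.2‖ ≤ _
        rw [norm_mul]
        exact (mul_le_mul hkn h2 (abs_nonneg _) hB).trans (by linarith))
    (fun p hp i hi => by
      rw [(hbd i p).fderiv]
      have habs : |p.1 i - p.2.2| = Δ p.2.2 := by
        have h1 : Δ p.2.2 ^ 2 = (p.1 i - p.2.2) ^ 2 := sub_eq_zero.1 hi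
        rw [sq_eq_sq_iff_abs_eq_abs, abs_of_pos (hΔ0 _)] at h1
        exact h1.symm
      have h2 := mul_pos (hk0 p.1)
        (hin p.1 p.2.2 i (fun j => (hnonneg j p).1 (hp j)) habs)
      simp [W]
      linarith)
    (z₀ := (x, 0, ν₀)) (fun i => (hpos i _).2 (hν₀ i))
  refine ⟨fun s => ((z s).1, (z s).2.1), by simp [hz0], fun s hs =>
    ⟨⟨(z s).2.2, fun i => (hpos i _).1 (hzb s hs i)⟩, ?_⟩⟩
  exact ((ContinuousLinearMap.fst ℝ (Fin N → ℝ) (ℝ × ℝ)).hasFDerivAt.comp_hasDerivWithinAt s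
    (hz s hs)).prodMk (((ContinuousLinearMap.fst ℝ ℝ ℝ).comp
    (ContinuousLinearMap.snd ℝ (Fin N → ℝ) (ℝ × ℝ))).hasFDerivAt.comp_hasDerivWithinAt s (hz s hs))

/-- If all points of `C` have solutions that stay in `C`, then the flow exists, and every flow
leaves `C` invariant. -/
lemma flow_of_forward_invariant {N : ℕ} {V : (Fin N → ℝ) → Fin N → ℝ} (hV : ContDiff ℝ 1 V)
    {C : Set (Fin N → ℝ)} (hsol : ∀ x ∈ C, ∃ z : ℝ → Fin N → ℝ, z 0 = x ∧ ∀ s ≥ 0, z s ∈ C ∧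
      HasDerivWithinAt z (V (z s)) (Ici 0) s) (t₀ : ℝ) :
    (∃ Φ, IsFlowOn V t₀ C Φ) ∧
      ∀ Φ, IsFlowOn V t₀ C Φ → ∀ X ∈ C, ∀ t ≥ t₀, Φ t X ∈ C := by
  choose! z hz0 hz using hsol
  have hd : ∀ X ∈ C, ∀ t ≥ t₀, HasDerivWithinAt (fun t => z X (t - t₀)) (V (z X (t - t₀)))
      (Ici t₀) t := by
    intro X hX t ht
    have h2 : HasDerivWithinAt (fun t : ℝ => t - t₀) 1 (Ici t₀) t :=
      (hasDerivWithinAt_id t _).sub_const _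
    have := ((hz X hX (t - t₀) (sub_nonneg.2 ht)).2).scomp (t' := Ici 0) t h2
      (fun s hs => by simpa using hs)
    rw [one_smul] at this
    exact this
  refine ⟨⟨fun t X => z X (t - t₀), fun X hX => ⟨by simp [hz0 X hX], hd X hX⟩⟩,
    fun Φ hΦ X hX t ht => ?_⟩
  have := solution_unique_autonomous hV
    (fun s hs => ((hΦ X hX).2 s hs.1).mono (Icc_subset_Ici_self : Icc t₀ t ⊆ _))
    (fun s hs => (hd X hX s hs.1).mono Icc_subset_Ici_self)
    (by simp [hz0 X hX, (hΦ X hX).1]) ⟨ht, le_rfl⟩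
  change Φ t X = z X (t - t₀) at this
  rw [this]
  exact (hz X hX _ (sub_nonneg.2 ht)).1

/-- A smooth bounded positive function that agrees with `v ↦ v⁻¹` on `[c, ∞)`. -/
lemma exists_smooth_recip {c : ℝ} (hc : 0 < c) : ∃ q : ℝ → ℝ, ContDiff ℝ 1 q ∧ (∀ v, 0 < q v) ∧
    (∀ v, q v ≤ 2 / c) ∧ ∀ v ≥ c, q v = v⁻¹ := by
  -- `χ` is the identity on `[c, ∞)` and at least `c / 2` everywhere, so its reciprocal is defined
  -- even where the speed is uncontrolled.
  let χ : ℝ → ℝ := fun v => c / 2 + (v - c / 2) * Real.smoothTransition ((v - c / 2) / (c / 2))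
  have hχ : ∀ v, c / 2 ≤ χ v := by
    intro v
    simp only [χ, le_add_iff_nonneg_right]
    rcases le_total v (c / 2) with h | h
    · rw [Real.smoothTransition.zero_of_nonpos
        (div_nonpos_of_nonpos_of_nonneg (by linarith) (by linarith)), mul_zero]
    · exact mul_nonneg (by linarith) (Real.smoothTransition.nonneg _)
  have hχ0 : ∀ v, 0 < χ v := fun v => (half_pos hc).trans_le (hχ v)
  have hχC : ContDiff ℝ 1 χ := contDiff_const.add ((contDiff_id.sub contDiff_const).mul
    (Real.smoothTransition.contDiff.comp ((contDiff_id.sub contDiff_const).div_const _)))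
  refine ⟨fun v => (χ v)⁻¹, hχC.inv fun v => (hχ0 v).ne', fun v => inv_pos.2 (hχ0 v), fun v => ?_,
    fun v hv => ?_⟩
  · rw [← inv_div]
    exact inv_anti₀ (half_pos hc) (hχ v)
  · simp only [χ]
    rw [Real.smoothTransition.one_of_one_le (by rw [le_div_iff₀ (half_pos hc)]; linarith)]
    congr 1
    ring

/-! ### Periodic functions and the weight. -/

section Periodic

lemma exists_norm_le_of_periodic {G : Type*} [NormedAddCommGroup G] {φ : ℝ → G}
    (hφ : Continuous φ) (hp : Function.Periodic φ 1) : ∃ B, ∀ ν, ‖φ ν‖ ≤ B := by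
  obtain ⟨B, hB⟩ := (isCompact_Icc (a := (0 : ℝ)) (b := 1)).exists_bound_of_continuousOn
    hφ.continuousOn
  refine ⟨B, fun ν => ?_⟩
  obtain ⟨y, hy, hyν⟩ := hp.exists_mem_Ico₀ one_pos ν
  rw [hyν]
  exact hB y (Ico_subset_Icc_self hy)

lemma exists_pos_le_of_periodic {φ : ℝ → ℝ} (hφ : Continuous φ) (hp : Function.Periodic φ 1)
    (hpos : ∀ s ∈ Icc (0 : ℝ) 1, 0 < φ s) : ∃ m > 0, ∀ ν, m ≤ φ ν := by
  obtain ⟨s, hs, hmin⟩ := (isCompact_Icc (a := (0 : ℝ)) (b := 1)).exists_isMinOn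
    ⟨0, by simp⟩ hφ.continuousOn
  refine ⟨φ s, hpos s hs, fun ν => ?_⟩
  obtain ⟨y, hy, hyν⟩ := hp.exists_mem_Ico₀ one_pos ν
  rw [hyν]
  exact hmin (Ico_subset_Icc_self hy)

/-- The exponential of the primitive of a periodic function, normalized to be periodic. -/
lemma exists_periodic_weight {g : ℝ → ℝ} (hg : Continuous g) (hp : Function.Periodic g 1) {γ : ℝ}
    (hγ : γ = -∫ s in (0 : ℝ)..1, g s) :
    ∃ w : ℝ → ℝ, Function.Periodic w 1 ∧ (∀ ν, 0 < w ν) ∧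
      (∀ ν, HasDerivAt w ((g ν + γ) * w ν) ν) ∧
      ∀ a b, Real.exp (∫ s in a..b, g s) = w b / w a * Real.exp (-γ * (b - a)) := by
  have hi : ∀ a b, IntervalIntegrable g MeasureTheory.volume a b := fun a b =>
    hg.intervalIntegrable a b
  refine ⟨fun ν => Real.exp ((∫ s in (0 : ℝ)..ν, g s) + γ * ν), fun ν => ?_,
    fun ν => Real.exp_pos _, fun ν => ?_, fun a b => ?_⟩
  · have h1 := hp.intervalIntegral_add_eq ν 0
    rw [zero_add] at h1
    have h2 := intervalIntegral.integral_add_adjacent_intervals (hi 0 ν) (hi ν (ν + 1))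
    change Real.exp _ = Real.exp _
    congr 1
    rw [← h2, h1, hγ]
    ring
  · have h1 : HasDerivAt (fun ν => ∫ s in (0 : ℝ)..ν, g s) (g ν) ν :=
      intervalIntegral.integral_hasDerivAt_right (hi _ _) (hg.stronglyMeasurableAtFilter _ _)
        hg.continuousAt
    refine ((h1.add ((hasDerivAt_id ν).const_mul γ)).exp).congr_deriv ?_
    simp only [Pi.add_apply, id]
    ring
  · rw [← Real.exp_sub, ← Real.exp_add]
    congr 1
    rw [← intervalIntegral.integral_add_adjacent_intervals (hi 0 a) (hi a b)]
    ring

end Periodic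

/-! ### Estimates for `F` and `H` near the diagonal. -/

/-- The point `(ν𝟙, ν)`. -/
def diagonal (N : ℕ) (ν : ℝ) : (Fin N → ℝ) × ℝ := (fun _ => ν, ν)

lemma diagonal_add_one (N : ℕ) (ν : ℝ) : diagonal N (ν + 1) = diagonal N ν + 1 := rfl

lemma continuous_diagonal (N : ℕ) : Continuous (diagonal N) :=
  (continuous_pi fun _ => continuous_id).prodMk continuous_id

/-- A continuous function that is invariant under `p ↦ p + 1` is uniformly continuous at the
diagonal. -/
lemma exists_uniform_near_diagonal {N : ℕ} {G : Type*} [NormedAddCommGroup G]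
    {Q : (Fin N → ℝ) × ℝ → G} (hQ : Continuous Q) (hp : Function.Periodic Q 1) {ε : ℝ}
    (hε : 0 < ε) : ∃ δ > 0, ∀ ν, ∀ p ∈ closedBall (diagonal N ν) δ,
      ‖Q p - Q (diagonal N ν)‖ ≤ ε := by
  have hK : IsCompact (diagonal N '' Icc 0 1) := isCompact_Icc.image (continuous_diagonal N)
  have hu := hK.uniformContinuousAt_of_continuousAt Q (fun p _ => hQ.continuousAt)
    (Metric.dist_mem_uniformity hε)
  obtain ⟨δ, hδ, hδu⟩ := Metric.mem_uniformity_dist.1 hu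
  refine ⟨δ / 2, half_pos hδ, fun ν p hpν => ?_⟩
  obtain ⟨n, hn⟩ : ∃ n : ℤ, ν - n ∈ Icc (0 : ℝ) 1 :=
    ⟨⌊ν⌋, by linarith [Int.floor_le ν], by linarith [Int.lt_floor_add_one ν]⟩
  have hshift : ∀ p, Q (p - n • 1) = Q p := fun p => hp.sub_zsmul_eq n
  have hd : diagonal N ν - n • 1 = diagonal N (ν - n) := by
    ext <;> simp [diagonal]
  have := hδu (a := diagonal N (ν - n)) (b := p - n • 1) (by
    rw [← hd, dist_sub_right, dist_comm]
    exact lt_of_le_of_lt hpν (half_lt_self hδ)) ⟨_, hn, rfl⟩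
  rw [← hd] at this
  simp only [mem_ofPred_eq, hshift] at this
  rw [dist_comm, dist_eq_norm] at this
  exact this.le

/-- Quantitative form of the statement that near the diagonal `F` is `C¹`-close to its values on
the diagonal. -/
structure DiagonalBounds {N : ℕ} (F : (Fin N → ℝ) → ℝ → ℝ) (m M ε δ : ℝ) : Prop where
  contDiff : ContDiff ℝ 1 (fun p : (Fin N → ℝ) × ℝ => F p.1 p.2)
  m_pos : 0 < m
  le_value : ∀ ν, m ≤ F (fun _ => ν) ν
  value_le : ∀ ν, F (fun _ => ν) ν ≤ M
  deriv_le : ∀ ν, ‖fderiv ℝ (fun p : (Fin N → ℝ) × ℝ => F p.1 p.2) (diagonal N ν)‖ ≤ M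
  value_near : ∀ ν, ∀ p ∈ closedBall (diagonal N ν) δ, |F p.1 p.2 - F (fun _ => ν) ν| ≤ ε
  deriv_near : ∀ ν, ∀ p ∈ closedBall (diagonal N ν) δ,
    ‖fderiv ℝ (fun p : (Fin N → ℝ) × ℝ => F p.1 p.2) p -
      fderiv ℝ (fun p : (Fin N → ℝ) × ℝ => F p.1 p.2) (diagonal N ν)‖ ≤ ε

/-- The derivative of `F` in its scalar argument, on the diagonal. -/
noncomputable def diagonalRate {N : ℕ} (F : (Fin N → ℝ) → ℝ → ℝ) (ν : ℝ) : ℝ :=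
  fderiv ℝ (fun p : (Fin N → ℝ) × ℝ => F p.1 p.2) (diagonal N ν) (0, 1)

lemma mem_closedBall_diagonal {N : ℕ} {ν δ : ℝ} {x : Fin N → ℝ} {z : ℝ}
    (hx : x ∈ closedBall (fun _ => ν) δ) (hz : |z - ν| ≤ δ) :
    ((x, z) : (Fin N → ℝ) × ℝ) ∈ closedBall (diagonal N ν) δ := by
  rw [mem_closedBall, Prod.dist_eq]
  exact max_le hx hz

lemma abs_sub_le_of_mem_closedBall {N : ℕ} {ν δ : ℝ} {x : Fin N → ℝ}
    (hx : x ∈ closedBall (fun _ => ν) δ) (i : Fin N) : |x i - ν| ≤ δ := by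
  have := (dist_le_pi_dist x (fun _ => ν) i).trans hx
  rwa [Real.dist_eq] at this

lemma mem_closedBall_of_abs_sub_le {N : ℕ} {ν δ : ℝ} {x : Fin N → ℝ} (hδ : 0 ≤ δ)
    (hx : ∀ i, |x i - ν| ≤ δ) : x ∈ closedBall (fun _ => ν) δ := by
  rw [mem_closedBall, dist_pi_le_iff hδ]
  exact hx

lemma closedBall_subset_band {N : ℕ} {ν δ : ℝ} (hδ : δ ≤ 1 / 2) :
    closedBall (fun _ : Fin N => ν) δ ⊆ band N := fun x hx i j => by
  have h1 := abs_sub_le_of_mem_closedBall hx i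
  have h2 := abs_sub_le_of_mem_closedBall hx j
  rw [abs_le] at *
  constructor <;> linarith

lemma DiagonalBounds.approx {N : ℕ} {F : (Fin N → ℝ) → ℝ → ℝ} {m M ε δ : ℝ}
    (h : DiagonalBounds F m M ε δ) {ν : ℝ} {p q : (Fin N → ℝ) × ℝ}
    (hp : p ∈ closedBall (diagonal N ν) δ) (hq : q ∈ closedBall (diagonal N ν) δ) :
    |F p.1 p.2 - F q.1 q.2 -
      fderiv ℝ (fun p : (Fin N → ℝ) × ℝ => F p.1 p.2) (diagonal N ν) (p - q)| ≤ ε * ‖p - q‖ :=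
  (convex_closedBall (diagonal N ν) δ).norm_image_sub_le_of_norm_fderiv_le'
    (fun x _ => h.contDiff.differentiable (by simp) x) (fun x hx => h.deriv_near ν x hx) hq hp

lemma abs_lt_of_normB_lt {N : ℕ} {H : (Fin N → ℝ) → Fin N → ℝ} {r : ℝ}
    (h : normB H < ENNReal.ofReal r) {y : Fin N → ℝ} (hy : y ∈ band N) (i : Fin N) :
    |H y i| < r := by
  have h1 : ‖H y i‖ₑ ≤ normB H := le_iSup₂_of_le y hy (le_iSup (fun i => ‖H y i‖ₑ) i)
  have h2 := h1.trans_lt h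
  rw [Real.enorm_eq_ofReal_abs, ENNReal.ofReal_lt_ofReal_iff_of_nonneg (abs_nonneg _)] at h2
  exact h2

lemma abs_pd_lt_of_normB1_lt {N : ℕ} {H : (Fin N → ℝ) → Fin N → ℝ} {r : ℝ}
    (h : normB1 H < ENNReal.ofReal r) {y : Fin N → ℝ} (hy : y ∈ band N) (i j : Fin N) :
    |pd j (fun z => H z i) y| < r := by
  have h1 : ‖pd j (fun z => H z i) y‖ₑ ≤ normB1 H :=
    le_iSup₂_of_le y hy (le_iSup₂ (f := fun i j => ‖pd j (fun z => H z i) y‖ₑ) i j)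
  have h2 := h1.trans_lt h
  rw [Real.enorm_eq_ofReal_abs, ENNReal.ofReal_lt_ofReal_iff_of_nonneg (abs_nonneg _)] at h2
  exact h2

lemma norm_le_of_abs_apply_single_le {N : ℕ} {A : (Fin N → ℝ) →L[ℝ] ℝ} {r : ℝ} (hr : 0 ≤ r)
    (h : ∀ j, |A (Pi.single j 1)| ≤ r) : ‖A‖ ≤ N * r := by
  refine A.opNorm_le_bound (by positivity) fun v => ?_
  have e : A v = ∑ j, v j * A (Pi.single j 1) := by
    conv_lhs => rw [← Finset.univ_sum_single v, map_sum]
    refine Finset.sum_congr rfl fun i _ => ?_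
    have : Pi.single i (v i) = v i • (Pi.single i 1 : Fin N → ℝ) := by
      rw [← Pi.single_smul, smul_eq_mul, mul_one]
    rw [this, map_smul, smul_eq_mul]
  rw [e]
  calc ‖∑ j, v j * A (Pi.single j 1)‖ ≤ ∑ _j : Fin N, ‖v‖ * r :=
        norm_sum_le_of_le _ fun j _ => by
          rw [norm_mul]
          exact mul_le_mul (norm_le_pi_norm v j) (h j) (norm_nonneg _) (norm_nonneg _)
    _ = N * r * ‖v‖ := by simp; ring

lemma abs_sub_le_of_normB1_lt {N : ℕ} {H : (Fin N → ℝ) → Fin N → ℝ} (hH : ContDiff ℝ 1 H)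
    {r δ : ℝ} (hr : 0 ≤ r) (h : normB1 H < ENNReal.ofReal r) (hδ : δ ≤ 1 / 2) {ν : ℝ}
    {x y : Fin N → ℝ} (hx : x ∈ closedBall (fun _ => ν) δ) (hy : y ∈ closedBall (fun _ => ν) δ)
    (i : Fin N) : |H x i - H y i| ≤ N * r * ‖x - y‖ := by
  have hd : Differentiable ℝ (fun z => H z i) :=
    differentiable_pi.1 (hH.differentiable (by simp)) i
  refine (convex_closedBall (fun _ => ν) δ).norm_image_sub_le_of_norm_fderiv_le (𝕜 := ℝ)
    (f := fun z => H z i) (fun z _ => hd z) (fun z hz => ?_) hy hx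
  exact norm_le_of_abs_apply_single_le hr fun j =>
    (abs_pd_lt_of_normB1_lt h (closedBall_subset_band hδ hz) i j).le

lemma norm_sub_prod_le {N : ℕ} {x y : Fin N → ℝ} (i : Fin N) :
    ‖((x, x i) : (Fin N → ℝ) × ℝ) - (y, y i)‖ ≤ ‖x - y‖ :=
  norm_prod_le_iff.2 ⟨le_rfl, norm_le_pi_norm (x - y) i⟩

/-! ### The perturbed field near the diagonal. -/

section Field

variable {N : ℕ} {F : (Fin N → ℝ) → ℝ → ℝ} {m M ε δ : ℝ} (h : DiagonalBounds F m M ε δ)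
  {H : (Fin N → ℝ) → Fin N → ℝ}
include h

lemma contDiff_field (hH : ContDiff ℝ 1 H) : ContDiff ℝ 1 (field F H) := by
  refine contDiff_pi.2 fun i => ?_
  exact (h.contDiff.comp (contDiff_id.prodMk (contDiff_apply ℝ ℝ i))).add (contDiff_pi.1 hH i)

lemma abs_field_sub_le (hHε : ∀ y ∈ band N, ∀ i, |H y i| ≤ ε) (hδ : δ ≤ 1 / 2) {ν : ℝ}
    {x : Fin N → ℝ} (hx : x ∈ closedBall (fun _ => ν) δ) (i : Fin N) :
    |field F H x i - F (fun _ => ν) ν| ≤ 2 * ε := by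
  have h1 := h.value_near ν (x, x i)
    (mem_closedBall_diagonal hx (abs_sub_le_of_mem_closedBall hx i))
  have h2 := hHε x (closedBall_subset_band hδ hx) i
  have e : field F H x i - F (fun _ => ν) ν = (F x (x i) - F (fun _ => ν) ν) + H x i := by
    simp only [field]; ring
  rw [e]
  exact (abs_add_le _ _).trans (by linarith)

/-- In the linearization at the diagonal the mean-field term is the same for every `i`; only the
scalar-argument term depends on `i`. The shared term is what later cancels. -/
lemma abs_field_sub_sub_le (hHlip : ∀ ν, ∀ x ∈ closedBall (fun _ => ν) δ,
      ∀ y ∈ closedBall (fun _ => ν) δ, ∀ i, |H x i - H y i| ≤ ε * ‖x - y‖) {ν : ℝ}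
    (hε : 0 ≤ ε) {x y : Fin N → ℝ} (hx : x ∈ closedBall (fun _ => ν) δ)
    (hy : y ∈ closedBall (fun _ => ν) δ) (i : Fin N) :
    |field F H x i - field F H y i -
      fderiv ℝ (fun p : (Fin N → ℝ) × ℝ => F p.1 p.2) (diagonal N ν) (x - y, 0) -
      diagonalRate F ν * (x i - y i)| ≤ 2 * ε * ‖x - y‖ := by
  have h1 := h.approx (mem_closedBall_diagonal hx (abs_sub_le_of_mem_closedBall hx i))
    (mem_closedBall_diagonal hy (abs_sub_le_of_mem_closedBall hy i))
  have h2 := hHlip ν x hx y hy i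
  have h3 := h1.trans (mul_le_mul_of_nonneg_left (norm_sub_prod_le i) hε)
  have e1 : ((x, x i) : (Fin N → ℝ) × ℝ) - (y, y i) = (x - y, 0) + (x i - y i) • (0, 1) := by
    ext <;> simp
  rw [e1, map_add, map_smul, smul_eq_mul] at h3
  have e : field F H x i - field F H y i -
      fderiv ℝ (fun p : (Fin N → ℝ) × ℝ => F p.1 p.2) (diagonal N ν) (x - y, 0) -
      diagonalRate F ν * (x i - y i) =
      (F x (x i) - F y (y i) -
        (fderiv ℝ (fun p : (Fin N → ℝ) × ℝ => F p.1 p.2) (diagonal N ν) (x - y, 0) +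
        (x i - y i) * fderiv ℝ (fun p : (Fin N → ℝ) × ℝ => F p.1 p.2) (diagonal N ν) (0, 1))) +
      (H x i - H y i) := by
    simp only [field, diagonalRate]; ring
  rw [e]
  refine (abs_add_le _ _).trans ?_
  linarith

/-- On the boundary of a tube whose radius grows faster than the distance of solutions, the field
points inwards. -/
lemma inward_on_boundary {Δ g : ℝ → ℝ} {γ G r : ℝ}
    (hg : ∀ ν, g ν * F (fun _ => ν) ν = diagonalRate F ν) (hG : ∀ ν, |g ν + γ| ≤ G)
    (hγ : 0 < γ) (hεG : (G + 1) * ε ≤ γ * m / 2) (hδ : δ ≤ 1 / 2)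
    (hΔ : ∀ ν, HasDerivAt Δ ((g ν + γ) * Δ ν) ν) (hΔ0 : ∀ ν, 0 < Δ ν) (hΔδ : ∀ ν, Δ ν ≤ δ)
    (hH : ∀ y ∈ band N, ∀ i, |H y i| < r) (hr : ∀ ν, r ≤ γ * m / 2 * Δ ν)
    (x : Fin N → ℝ) (ν : ℝ) (i : Fin N) (hx : ∀ j, |x j - ν| ≤ Δ ν) (hi : |x i - ν| = Δ ν) :
    0 < Δ ν * deriv Δ ν * F x ν - (x i - ν) * (field F H x i - F x ν) := by
  have hδ0 : 0 ≤ δ := (hΔ0 ν).le.trans (hΔδ ν)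
  have hxb : x ∈ closedBall (fun _ => ν) δ :=
    mem_closedBall_of_abs_sub_le hδ0 fun j => (hx j).trans (hΔδ ν)
  have hp1 := mem_closedBall_diagonal hxb (z := ν) (by simpa using hδ0)
  have hp2 := mem_closedBall_diagonal hxb (abs_sub_le_of_mem_closedBall hxb i)
  have h1 := h.value_near ν _ hp1
  have h2 := h.approx hp2 hp1
  have e1 : ((x, x i) : (Fin N → ℝ) × ℝ) - (x, ν) = (x i - ν) • (0, 1) := by
    ext <;> simp
  have e2 : ‖(x i - ν) • ((0, 1) : (Fin N → ℝ) × ℝ)‖ = Δ ν := by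
    rw [norm_smul, Prod.norm_def]
    simp [hi]
  rw [e1, e2, map_smul, smul_eq_mul] at h2
  change |F x (x i) - F x ν - (x i - ν) * diagonalRate F ν| ≤ ε * Δ ν at h2
  have h3 := (hH x (closedBall_subset_band hδ hxb) i).trans_le (hr ν)
  rw [(hΔ ν).deriv]
  change |F x ν - F (fun _ => ν) ν| ≤ ε at h1
  set f := F (fun _ => ν) ν
  set u := x i - ν
  set d := Δ ν
  have hd : 0 < d := hΔ0 ν
  have hu2 : u * u = d * d := by rw [← hi, abs_mul_abs_self]
  have hf : m ≤ f := h.le_value ν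
  set e₁ := F x ν - f with he₁
  set e₂ := F x (x i) - F x ν - u * diagonalRate F ν with he₂
  -- On `|x i - ν| = Δ ν` the terms with `g` cancel and leave `γ f Δ²`, where `f ≥ m`. Half of it
  -- pays for the errors `e₁`, `e₂` (`hεG`), the other half for `H` (`hr`), strictly.
  have key : d * ((g ν + γ) * d) * F x ν - u * (field F H x i - F x ν) =
      d * (d * (γ * f) + d * ((g ν + γ) * e₁)) - u * e₂ - u * H x i := by
    have e3 : field F H x i - F x ν = e₂ + u * (g ν * f) + H x i := by
      rw [hg, he₂]; simp only [field]; ring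
    rw [e3, show F x ν = f + e₁ by rw [he₁]; ring]
    linear_combination (-(g ν * f)) * hu2
  rw [key]
  have b1 : |(g ν + γ) * e₁| ≤ G * ε := by
    rw [abs_mul]
    exact mul_le_mul (hG ν) h1 (abs_nonneg _) ((abs_nonneg _).trans (hG ν))
  have b2 : u * e₂ ≤ d * (ε * d) :=
    (le_abs_self _).trans (by rw [abs_mul, hi]; exact mul_le_mul_of_nonneg_left h2 hd.le)
  have b3 : u * H x i < d * (γ * m / 2 * d) :=
    (le_abs_self _).trans_lt (by rw [abs_mul, hi]; exact mul_lt_mul_of_pos_left h3 hd)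
  have b4 : -(G * ε) ≤ (g ν + γ) * e₁ := (abs_le.1 b1).1
  have b5 : γ * m ≤ γ * f := mul_le_mul_of_nonneg_left hf hγ.le
  have hdd : 0 < d * d := mul_pos hd hd
  have b6 : d * d * (γ * m / 2 + ε) ≤ d * d * (γ * f + (g ν + γ) * e₁) :=
    mul_le_mul_of_nonneg_left (by linarith) hdd.le
  have e4 : d * (d * (γ * f) + d * ((g ν + γ) * e₁)) = d * d * (γ * f + (g ν + γ) * e₁) := by ring
  have e5 : d * d * (γ * m / 2 + ε) = d * (γ * m / 2 * d) + d * (ε * d) := by ring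
  linarith

lemma half_le_field (hHε : ∀ y ∈ band N, ∀ i, |H y i| ≤ ε) (hδ : δ ≤ 1 / 2) (hεm : ε ≤ m / 4)
    {ν : ℝ} {x : Fin N → ℝ} (hx : x ∈ closedBall (fun _ => ν) δ) (i : Fin N) :
    m / 2 ≤ field F H x i := by
  have h1 := (abs_le.1 (abs_field_sub_le h hHε hδ hx i)).1
  linarith [h.le_value ν]

lemma field_le (hHε : ∀ y ∈ band N, ∀ i, |H y i| ≤ ε) (hδ : δ ≤ 1 / 2) (hεm : ε ≤ m / 4)
    {ν : ℝ} {x : Fin N → ℝ} (hx : x ∈ closedBall (fun _ => ν) δ) (i : Fin N) :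
    field F H x i ≤ M + m := by
  have h1 := (abs_le.1 (abs_field_sub_le h hHε hδ hx i)).2
  linarith [h.value_le ν, h.m_pos]

-- Here `A`, `B` are the `l`-th components at two points, `Xi`, `Ci` the `i`-th ones. Over a common
-- denominator the shared increment `q` is multiplied only by `B - Ci`, which is `O(ε)`.
omit h in
lemma abs_div_sub_div_sub_le {A B Ci Xi a q w W f e₁ e₂ ε M m : ℝ} (hm : 0 < m) (hε : 0 ≤ ε)
    (hW : 0 ≤ W) (hA : m / 2 ≤ A) (hB : m / 2 ≤ B) (hf : m ≤ f) (hBM : B ≤ M + m)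
    (hCi : |Ci| ≤ M + m) (hAf : |A - f| ≤ 2 * ε) (hBC : |B - Ci| ≤ 4 * ε) (ha : |a| ≤ M)
    (hq : |q| ≤ M * W) (hw : |w| ≤ W) (he₁ : |e₁| ≤ 2 * ε * W) (he₂ : |e₂| ≤ 2 * ε * W)
    (hX : Xi = Ci + q + a * w + e₁) (hAB : A = B + q + e₂) :
    |Xi / A - Ci / B - a / f * w| ≤ ε * (10 * M + 4 * m) / (m / 2) ^ 2 * W := by
  have hA0 : 0 < A := by linarith
  have hB0 : 0 < B := by linarith
  have hf0 : 0 < f := by linarith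
  have hM0 : 0 ≤ M := (abs_nonneg _).trans ha
  have hmm : (m / 2) ^ 2 ≤ A * B := by
    rw [sq]; exact mul_le_mul hA hB (by linarith) hA0.le
  have hmf : (m / 2) ^ 2 ≤ A * f := by
    rw [sq]; exact mul_le_mul hA (by linarith) (by linarith) hA0.le
  have hm2 : 0 < (m / 2) ^ 2 := by positivity
  have e : Xi / A - Ci / B - a / f * w =
      (q * (B - Ci) + e₁ * B - Ci * e₂) / (A * B) - a * w * (A - f) / (A * f) := by
    rw [hX]
    field_simp
    rw [hAB]
    ring
  have n1 : |q * (B - Ci) + e₁ * B - Ci * e₂| ≤ ε * (8 * M + 4 * m) * W := by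
    have t1 : |q * (B - Ci)| ≤ M * W * (4 * ε) := by
      rw [abs_mul]; exact mul_le_mul hq hBC (abs_nonneg _) (by positivity)
    have t2 : |e₁ * B| ≤ 2 * ε * W * (M + m) := by
      rw [abs_mul, abs_of_pos hB0]; exact mul_le_mul he₁ hBM hB0.le (by positivity)
    have t3 : |Ci * e₂| ≤ (M + m) * (2 * ε * W) := by
      rw [abs_mul]; exact mul_le_mul hCi he₂ (abs_nonneg _) (by positivity)
    calc _ ≤ |q * (B - Ci)| + |e₁ * B| + |Ci * e₂| :=
          (abs_sub _ _).trans (add_le_add_left (abs_add_le _ _) _)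
      _ ≤ M * W * (4 * ε) + 2 * ε * W * (M + m) + (M + m) * (2 * ε * W) := by linarith
      _ = _ := by ring
  have n2 : |a * w * (A - f)| ≤ 2 * M * ε * W := by
    rw [abs_mul, abs_mul]
    calc |a| * |w| * |A - f| ≤ M * W * (2 * ε) :=
          mul_le_mul (mul_le_mul ha hw (abs_nonneg _) hM0) hAf (abs_nonneg _) (by positivity)
      _ = _ := by ring
  rw [e]
  calc _ ≤ |(q * (B - Ci) + e₁ * B - Ci * e₂) / (A * B)| + |a * w * (A - f) / (A * f)| :=
        abs_sub _ _
    _ ≤ ε * (8 * M + 4 * m) * W / (m / 2) ^ 2 + 2 * M * ε * W / (m / 2) ^ 2 := by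
        rw [abs_div, abs_div, abs_of_pos (mul_pos hA0 hB0), abs_of_pos (mul_pos hA0 hf0)]
        exact add_le_add (div_le_div₀ (by positivity) n1 hm2 hmm)
          (div_le_div₀ (by positivity) n2 hm2 hmf)
    _ = _ := by ring

/-- With the `l`-th component as independent variable, differences of solutions near the diagonal
contract at the rate `∂_{N+1}F / F` up to a small error. -/
lemma norm_rescaled_sub_le (hHε : ∀ y ∈ band N, ∀ i, |H y i| ≤ ε) (hδ : δ ≤ 1 / 2)
    (hHlip : ∀ ν, ∀ x ∈ closedBall (fun _ => ν) δ,
      ∀ y ∈ closedBall (fun _ => ν) δ, ∀ i, |H x i - H y i| ≤ ε * ‖x - y‖)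
    (hε : 0 ≤ ε) (hεm : ε ≤ m / 4) {l : Fin N} {x y : Fin N → ℝ} (hxy : x l = y l)
    (hx : x ∈ closedBall (fun _ => x l) δ) (hy : y ∈ closedBall (fun _ => x l) δ) :
    ‖(field F H x l)⁻¹ • field F H x - (field F H y l)⁻¹ • field F H y -
        (diagonalRate F (x l) / F (fun _ => x l) (x l)) • (x - y)‖ ≤
      ε * (10 * M + 4 * m) / (m / 2) ^ 2 * ‖x - y‖ ∧
    |(field F H x l)⁻¹ - (field F H y l)⁻¹| ≤ (M + 2 * ε) / (m / 2) ^ 2 * ‖x - y‖ := by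
  have hm := h.m_pos
  have hM : 0 ≤ M := (norm_nonneg _).trans (h.deriv_le 0)
  let A := fderiv ℝ (fun p : (Fin N → ℝ) × ℝ => F p.1 p.2) (diagonal N (x l))
  set q := fderiv ℝ (fun p : (Fin N → ℝ) × ℝ => F p.1 p.2) (diagonal N (x l)) (x - y, 0) with hq
  have hA := half_le_field h hHε hδ hεm hx
  have hB := half_le_field h hHε hδ hεm hy
  have hqb : |q| ≤ M * ‖x - y‖ := by
    refine (A.le_opNorm _).trans ?_
    refine mul_le_mul (h.deriv_le _) ?_ (norm_nonneg _) hM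
    exact norm_prod_le_iff.2 ⟨le_rfl, by simp⟩
  have hab : |diagonalRate F (x l)| ≤ M := by
    refine (A.le_opNorm _).trans ?_
    refine (mul_le_of_le_one_right (norm_nonneg _) ?_).trans (h.deriv_le _)
    exact norm_prod_le_iff.2 ⟨by simp, by simp⟩
  have hd := abs_field_sub_sub_le h hHlip hε hx hy
  have hdl := hd l
  -- At equal phase the scalar term is absent from the `l`-th component, leaving the shared `q`.
  rw [hxy, sub_self, mul_zero, sub_zero, ← hxy] at hdl
  constructor
  · rw [pi_norm_le_iff_of_nonneg (by positivity)]
    intro i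
    have hBi := abs_field_sub_le h hHε hδ hy i
    have hBl := abs_field_sub_le h hHε hδ hy l
    have hBC : |field F H y l - field F H y i| ≤ 4 * ε := by
      rw [abs_le] at *
      constructor <;> linarith [hBi.1, hBi.2, hBl.1, hBl.2]
    have := abs_div_sub_div_sub_le (Xi := field F H x i) (w := x i - y i)
      (e₁ := field F H x i - field F H y i - q - diagonalRate F (x l) * (x i - y i))
      (e₂ := field F H x l - field F H y l - q) hm hε (norm_nonneg (x - y))
      (hA l) (hB l) (h.le_value (x l)) (field_le h hHε hδ hεm hy l)
      (by rw [abs_of_nonneg (by linarith [hB i])]; exact field_le h hHε hδ hεm hy i)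
      (abs_field_sub_le h hHε hδ hx l) hBC hab hqb (norm_le_pi_norm (x - y) i) (hd i) hdl
      (by ring) (by ring)
    simpa [div_eq_inv_mul, mul_comm, mul_assoc, mul_left_comm] using this
  · have hA0 : 0 < field F H x l := by linarith [hA l]
    have hB0 : 0 < field F H y l := by linarith [hB l]
    rw [inv_sub_inv hA0.ne' hB0.ne', abs_div, abs_of_pos (mul_pos hA0 hB0), abs_sub_comm,
      div_mul_eq_mul_div]
    refine div_le_div₀ (by positivity) ?_ (by positivity) ?_
    · have e : field F H x l - field F H y l = (field F H x l - field F H y l - q) + q := by ring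
      rw [e]
      exact (abs_add_le _ _).trans (by linarith)
    · rw [sq]
      exact mul_le_mul (hA l) (hB l) (by linarith) hA0.le

end Field

/-! ### Constants extracted from (H). -/

lemma DiagonalBounds.mono {N : ℕ} {F : (Fin N → ℝ) → ℝ → ℝ} {m M ε δ δ' : ℝ}
    (h : DiagonalBounds F m M ε δ) (hδ : δ' ≤ δ) : DiagonalBounds F m M ε δ' :=
  { h with
    value_near := fun ν p hp => h.value_near ν p (closedBall_subset_closedBall hδ hp)
    deriv_near := fun ν p hp => h.deriv_near ν p (closedBall_subset_closedBall hδ hp) }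

lemma HypH.periodic_prod {N : ℕ} {F : (Fin N → ℝ) → ℝ → ℝ} (hF : HypH F) :
    Function.Periodic (fun p : (Fin N → ℝ) × ℝ => F p.1 p.2) 1 :=
  fun p => hF.periodic p.1 p.2

lemma HypH.periodic_fderiv {N : ℕ} {F : (Fin N → ℝ) → ℝ → ℝ} (hF : HypH F) :
    Function.Periodic (fderiv ℝ (fun p : (Fin N → ℝ) × ℝ => F p.1 p.2)) 1 := fun p => by
  have h1 := fderiv_comp_add_right (𝕜 := ℝ) (f := fun p : (Fin N → ℝ) × ℝ => F p.1 p.2) (x := p) 1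
  have h2 : (fun p : (Fin N → ℝ) × ℝ => (fun p : (Fin N → ℝ) × ℝ => F p.1 p.2) (p + 1)) =
      fun p : (Fin N → ℝ) × ℝ => F p.1 p.2 := funext hF.periodic_prod
  rw [h2] at h1
  exact h1.symm

lemma HypH.continuous_fderiv {N : ℕ} {F : (Fin N → ℝ) → ℝ → ℝ} (hF : HypH F) :
    Continuous (fderiv ℝ (fun p : (Fin N → ℝ) × ℝ => F p.1 p.2)) :=
  hF.contDiff.continuous_fderiv (by simp)

lemma HypH.continuous_diagonal_value {N : ℕ} {F : (Fin N → ℝ) → ℝ → ℝ} (hF : HypH F) :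
    Continuous (fun ν => F (fun _ => ν) ν) :=
  hF.contDiff.continuous.comp (continuous_diagonal N)

lemma HypH.periodic_diagonal_value {N : ℕ} {F : (Fin N → ℝ) → ℝ → ℝ} (hF : HypH F) :
    Function.Periodic (fun ν => F (fun _ => ν) ν) 1 :=
  fun ν => hF.periodic (fun _ => ν) ν

/-- Periodicity reduces everything to `[0, 1]`. The constants `m` and `M` precede `ε`, which can
therefore be chosen in terms of them. -/
lemma HypH.exists_diagonalBounds {N : ℕ} {F : (Fin N → ℝ) → ℝ → ℝ} (hF : HypH F) :
    ∃ m M, 0 < m ∧ 0 < M ∧ (∀ ν, m ≤ F (fun _ => ν) ν) ∧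
      ∀ ε > 0, ∃ δ > 0, DiagonalBounds F m M ε δ := by
  obtain ⟨m, hm, hmf⟩ := exists_pos_le_of_periodic hF.continuous_diagonal_value
    hF.periodic_diagonal_value hF.pos
  obtain ⟨M₁, hM₁⟩ := exists_norm_le_of_periodic hF.continuous_diagonal_value
    hF.periodic_diagonal_value
  obtain ⟨M₂, hM₂⟩ := exists_norm_le_of_periodic (hF.continuous_fderiv.comp (continuous_diagonal N))
    (fun ν => by
      simp only [Function.comp_apply, diagonal_add_one]
      exact hF.periodic_fderiv _)
  have hfM : ∀ ν, F (fun _ => ν) ν ≤ max M₁ M₂ := fun ν =>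
    ((le_abs_self _).trans (hM₁ ν)).trans (le_max_left _ _)
  refine ⟨m, max M₁ M₂, hm, (hm.trans_le (hmf 0)).trans_le (hfM 0), hmf, fun ε hε => ?_⟩
  obtain ⟨δ₁, hδ₁, h₁⟩ := exists_uniform_near_diagonal hF.contDiff.continuous hF.periodic_prod hε
  obtain ⟨δ₂, hδ₂, h₂⟩ := exists_uniform_near_diagonal hF.continuous_fderiv hF.periodic_fderiv hε
  exact ⟨min δ₁ δ₂, lt_min hδ₁ hδ₂,
    { contDiff := hF.contDiff.of_le (by norm_num)
      m_pos := hm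
      le_value := hmf
      value_le := hfM
      deriv_le := fun ν => (hM₂ ν).trans (le_max_right _ _)
      value_near := fun ν p hp => h₁ ν p (closedBall_subset_closedBall (min_le_left _ _) hp)
      deriv_near := fun ν p hp => h₂ ν p (closedBall_subset_closedBall (min_le_right _ _) hp) }⟩

lemma HypH.deriv_eq_diagonalRate {N : ℕ} {F : (Fin N → ℝ) → ℝ → ℝ} (hF : HypH F) (s : ℝ) :
    deriv (fun z => F (fun _ => s) z) s = diagonalRate F s := by
  have h1 : HasFDerivAt (fun p : (Fin N → ℝ) × ℝ => F p.1 p.2) _ (diagonal N s) :=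
    (hF.contDiff.differentiable (by simp) (diagonal N s)).hasFDerivAt
  have h2 : HasDerivAt (fun z : ℝ => (((fun _ => s), z) : (Fin N → ℝ) × ℝ)) (0, 1) s :=
    (hasDerivAt_const s _).prodMk (hasDerivAt_id s)
  exact (HasFDerivAt.comp_hasDerivAt (f := fun z : ℝ => (((fun _ => s), z) : (Fin N → ℝ) × ℝ))
    s h1 h2).deriv

/-! ### The tube as synchronization region. -/

section Tube

variable {N : ℕ} {F : (Fin N → ℝ) → ℝ → ℝ} {m M ε δ γ G r D : ℝ} {Δ g : ℝ → ℝ}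
  {H : (Fin N → ℝ) → Fin N → ℝ}

/-- Recentring at the phase `x l` instead of `ν` costs a factor two, hence `2 * D ≤ δ`. -/
lemma mem_closedBall_of_mem_tube (hΔD : ∀ ν, Δ ν ≤ D) (hD : 2 * D ≤ δ) {x : Fin N → ℝ}
    (hx : x ∈ tube N Δ) (l : Fin N) : x ∈ closedBall (fun _ => x l) δ := by
  obtain ⟨ν, hν⟩ := hx
  have hD0 : 0 ≤ D := (abs_nonneg _).trans ((hν l).le.trans (hΔD ν))
  refine mem_closedBall_of_abs_sub_le (by linarith) fun i => ?_
  have h1 := abs_lt.1 (hν i)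
  have h2 := abs_lt.1 (hν l)
  have h3 := hΔD ν
  rw [abs_le]
  constructor <;> linarith [h1.1, h1.2, h2.1, h2.2]

variable (h : DiagonalBounds F m M ε δ)
  (hg : ∀ ν, g ν * F (fun _ => ν) ν = diagonalRate F ν) (hG : ∀ ν, |g ν + γ| ≤ G)
  (hγ : 0 < γ) (hεG : (G + 1) * ε ≤ γ * m / 2) (hεm : ε ≤ m / 4) (hδ : δ ≤ 1 / 2)
  (hΔ : ∀ ν, HasDerivAt Δ ((g ν + γ) * Δ ν) ν) (hΔ0 : ∀ ν, 0 < Δ ν) (hΔC : ContDiff ℝ 1 Δ)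
  (hΔD : ∀ ν, Δ ν ≤ D) (hD : 2 * D ≤ δ) (hHC : ContDiff ℝ 1 H)
  (hH : ∀ y ∈ band N, ∀ i, |H y i| < r) (hr : ∀ ν, r ≤ γ * m / 2 * Δ ν) (hrε : r ≤ ε)

include h hδ hεm hΔD hD hH hrε

lemma norm_field_le_of_mem_tube {x : Fin N → ℝ} (hx : x ∈ tube N Δ) :
    (∀ i, m / 2 ≤ field F H x i) ∧ ‖field F H x‖ ≤ M + m := by
  have hHε : ∀ y ∈ band N, ∀ i, |H y i| ≤ ε := fun y hy i => (hH y hy i).le.trans hrε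
  have hm := h.m_pos
  have hM : 0 ≤ M := (norm_nonneg _).trans (h.deriv_le 0)
  have h1 : ∀ i, m / 2 ≤ field F H x i := fun i =>
    half_le_field h hHε hδ hεm (mem_closedBall_of_mem_tube hΔD hD hx i) i
  refine ⟨h1, (pi_norm_le_iff_of_nonneg (by positivity)).2 fun i => ?_⟩
  rw [Real.norm_eq_abs, abs_of_nonneg (by linarith [h1 i])]
  exact field_le h hHε hδ hεm (mem_closedBall_of_mem_tube hΔD hD hx i) i

include hg hG hγ hεG hΔ hΔ0 hΔC hHC hr

/-- Serves twice: with `k = 1` for the flow in time, and with the reciprocal speed for the phase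
flow. -/
lemma exists_rescaled_solution_mem_tube {k : (Fin N → ℝ) → ℝ} (hk : ContDiff ℝ 1 k)
    (hk0 : ∀ x, 0 < k x) {B : ℝ} (hkB : ∀ x, k x ≤ B) {x : Fin N → ℝ} (hx : x ∈ tube N Δ) :
    ∃ z : ℝ → (Fin N → ℝ) × ℝ, z 0 = (x, 0) ∧ ∀ s ≥ 0, (z s).1 ∈ tube N Δ ∧
      HasDerivWithinAt z (k (z s).1 • field F H (z s).1, k (z s).1) (Ici 0) s := by
  have hD0 : 0 < D := (hΔ0 0).trans_le (hΔD 0)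
  have hΔδ : ∀ ν, Δ ν ≤ δ := fun ν => (hΔD ν).trans (by linarith)
  refine exists_solution_mem_tube (contDiff_field h hHC) h.contDiff hk hk0 hkB hΔC hΔ0
    (L := M + m) (fun y ν hy => ⟨?_, ?_⟩)
    (inward_on_boundary h hg hG hγ hεG hδ hΔ hΔ0 hΔδ hH hr) hx
  · exact (norm_field_le_of_mem_tube h hεm hδ hΔD hD hH hrε ⟨ν, hy⟩).2
  · have hm := h.m_pos
    have hyb : y ∈ closedBall (fun _ => ν) δ :=
      mem_closedBall_of_abs_sub_le (by linarith) fun j => (hy j).le.trans (hΔδ ν)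
    have h1 := h.value_near ν (y, ν) (mem_closedBall_diagonal hyb (by simp; linarith))
    rw [abs_le] at h1
    have h2 := h.le_value ν
    have h3 := h.value_le ν
    rw [abs_of_nonneg] <;> linarith [h1.1, h1.2]

lemma forward_invariant_tube (t₀ : ℝ) :
    (∃ Φ, IsFlowOn (field F H) t₀ (tube N Δ) Φ) ∧
      ∀ Φ, IsFlowOn (field F H) t₀ (tube N Δ) Φ → ∀ X ∈ tube N Δ, ∀ t ≥ t₀, Φ t X ∈ tube N Δ := by
  refine flow_of_forward_invariant (contDiff_field h hHC) (fun x hx => ?_) t₀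
  obtain ⟨z, hz0, hz⟩ := exists_rescaled_solution_mem_tube h hg hG hγ hεG hεm hδ hΔ hΔ0 hΔC hΔD hD
    hHC hH hr hrε (k := fun _ => 1) contDiff_const (fun _ => one_pos) (fun _ => le_rfl) hx
  refine ⟨fun s => (z s).1, by simp [hz0], fun s hs => ⟨(hz s hs).1, ?_⟩⟩
  have := (ContinuousLinearMap.fst ℝ (Fin N → ℝ) ℝ).hasFDerivAt.comp_hasDerivWithinAt s (hz s hs).2
  simpa using! this

lemma isSynchronized_tube (t₀ : ℝ) : IsSynchronized (field F H) t₀ D (tube N Δ) := by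
  obtain ⟨hex, hinv⟩ := forward_invariant_tube h hg hG hγ hεG hεm hδ hΔ hΔ0 hΔC hΔD hD
    hHC hH hr hrε t₀
  refine ⟨hex, fun Φ hΦ X hX => ⟨hinv Φ hΦ X hX, ⟨m / 2, half_pos h.m_pos, fun i t ht => ?_⟩,
    fun i j t ht => ?_⟩⟩
  · rw [((hasDerivWithinAt_pi.1 ((hΦ X hX).2 t ht)) i).derivWithin (uniqueDiffOn_Ici t₀ t ht)]
    exact (norm_field_le_of_mem_tube h hεm hδ hΔD hD hH hrε (hinv Φ hΦ X hX t ht)).1 i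
  · obtain ⟨ν, hν⟩ := hinv Φ hΦ X hX t ht
    have h1 := abs_lt.1 (hν i)
    have h2 := abs_lt.1 (hν j)
    have h3 := hΔD ν
    rw [abs_lt]
    constructor <;> linarith [h1.1, h1.2, h2.1, h2.2]

lemma exists_phaseContraction (l : Fin N) (hgc : Continuous g)
    (hHlip : ∀ ν, ∀ x ∈ closedBall (fun _ => ν) δ,
      ∀ y ∈ closedBall (fun _ => ν) δ, ∀ i, |H x i - H y i| ≤ ε * ‖x - y‖)
    (hε : 0 ≤ ε) (hεγ : ε * (10 * M + 4 * m) / (m / 2) ^ 2 ≤ γ / 2) {w : ℝ → ℝ} {w₀ w₁ : ℝ}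
    (hw₀ : 0 < w₀) (hw : ∀ ν, w₀ ≤ w ν) (hw₁ : ∀ ν, w ν ≤ w₁)
    (hwg : ∀ a b, Real.exp (∫ s in a..b, g s) = w b / w a * Real.exp (-γ * (b - a))) :
    ∃ k c L κ C₁ K₀ β, PhaseContraction l (tube N Δ) (field F H) k g c L κ C₁ K₀ β := by
  have hm := h.m_pos
  have hM : 0 ≤ M := (norm_nonneg _).trans (h.deriv_le 0)
  have hHε : ∀ y ∈ band N, ∀ i, |H y i| ≤ ε := fun y hy i => (hH y hy i).le.trans hrε
  obtain ⟨q, hqC, hq0, hqB, hq⟩ := exists_smooth_recip (half_pos hm)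
  have hspeed : ∀ x ∈ tube N Δ, m / 2 ≤ field F H x l := fun x hx =>
    (norm_field_le_of_mem_tube h hεm hδ hΔD hD hH hrε hx).1 l
  have hkC : ContDiff ℝ 1 (fun x => q (field F H x l)) :=
    hqC.comp (contDiff_pi.1 (contDiff_field h hHC) l)
  have hgeq : ∀ ν, g ν = diagonalRate F ν / F (fun _ => ν) ν := fun ν => by
    rw [← hg, mul_div_cancel_right₀]
    exact (hm.trans_le (h.le_value ν)).ne'
  have hest : ∀ x ∈ tube N Δ, ∀ y ∈ tube N Δ, x l = y l → _ := fun x hx y hy hxy =>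
    norm_rescaled_sub_le h hHε hδ hHlip hε hεm hxy (mem_closedBall_of_mem_tube hΔD hD hx l)
      (by rw [hxy]; exact mem_closedBall_of_mem_tube hΔD hD hy l)
  -- Of the mean rate `γ`, one half is given to the error `κ` and the other remains as `β`; `w₁ /
  -- w₀` bounds the oscillation of the weight.
  refine ⟨fun x => q (field F H x l), m / 2, M + m, γ / 2, (M + 2 * ε) / (m / 2) ^ 2,
    w₁ / w₀, γ / 2,
    { isOpen := isOpen_tube N Δ
      contDiff_field := contDiff_field h hHC
      contDiff_recip := hkC
      recip_eq := fun x hx => hq _ (hspeed x hx)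
      c_pos := half_pos hm
      le_speed := hspeed
      norm_le := fun x hx => (norm_field_le_of_mem_tube h hεm hδ hΔD hD hH hrε hx).2
      contract := fun x hx y hy hxy => ?_
      recip_lip := fun x hx y hy hxy => ?_
      continuous_rate := hgc
      β_pos := half_pos hγ
      K₀_nonneg := div_nonneg ((hw₀.le.trans (hw 0)).trans (hw₁ 0)) hw₀.le
      C₁_nonneg := by positivity
      average := fun a b hab => ?_
      exists_flow := fun x hx => exists_rescaled_solution_mem_tube h hg hG hγ hεG hεm hδ hΔ hΔ0 hΔC
        hΔD hD hHC hH hr hrε hkC (fun _ => hq0 _) (fun _ => hqB _) hx }⟩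
  · rw [hq _ (hspeed x hx), hq _ (hspeed y hy), hgeq]
    exact (hest x hx y hy hxy).1.trans (mul_le_mul_of_nonneg_right hεγ (norm_nonneg _))
  · rw [hq _ (hspeed x hx), hq _ (hspeed y hy)]
    exact (hest x hx y hy hxy).2
  · rw [hwg, mul_assoc, ← Real.exp_add]
    have e : -γ * (b - a) + γ / 2 * (b - a) = -(γ / 2) * (b - a) := by ring
    rw [e]
    exact mul_le_mul_of_nonneg_right (div_le_div₀ ((hw₀.le.trans (hw 0)).trans (hw₁ 0)) (hw₁ b)
      hw₀ (hw a)) (Real.exp_pos _).le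

end Tube

end MeanField

/-! ### Choice of constants and conclusion. -/

open MeanField in
theorem mainTheorem1 {N : ℕ} (hN : 2 ≤ N) (F : (Fin N → ℝ) → ℝ → ℝ)
    (hF : MeanField.HypH F) (hFstar : MeanField.HypHStar F) :
    ∃ Dstar > (0 : ℝ), ∀ D ∈ Set.Ioc 0 Dstar, ∃ r > (0 : ℝ), ∃ Δ : ℝ → ℝ,
      MeanField.IsTubeRadius D Δ ∧
      (∀ H : (Fin N → ℝ) → Fin N → ℝ, ContDiff ℝ 1 H →
        MeanField.normB H < ENNReal.ofReal r →
        ∀ t₀ : ℝ, MeanField.IsSynchronized (MeanField.field F H) t₀ D (MeanField.tube N Δ)) ∧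
      ∀ H : (Fin N → ℝ) → Fin N → ℝ, ContDiff ℝ 1 H →
        max (MeanField.normB H) (MeanField.normB1 H) < ENNReal.ofReal r →
        ∀ (t₀ : ℝ) (Φ : ℝ → (Fin N → ℝ) → Fin N → ℝ),
          MeanField.IsFlowOn (MeanField.field F H) t₀ (MeanField.tube N Δ) Φ →
          (∃ M > (0 : ℝ), ∀ X ∈ MeanField.tube N Δ, ∃ δ > (0 : ℝ),
            ∀ Y ∈ MeanField.tube N Δ, Y ≠ X → ‖X - Y‖ < δ →
              ∀ t ≥ t₀, ‖Φ t X - Φ t Y‖ < M * ‖X - Y‖) ∧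
          ∃ W : (Fin N → ℝ) → Set (Fin N → ℝ),
            (∀ X ∈ MeanField.tube N Δ, X ∈ W X ∧ W X ⊆ MeanField.tube N Δ ∧
              MeanField.IsC1Submanifold (N - 1) (W X)) ∧
            ∃ β > (0 : ℝ), ∃ K > (0 : ℝ), ∀ X ∈ MeanField.tube N Δ, ∀ Y ∈ W X, Y ≠ X →
              ∀ t ≥ t₀, ‖Φ t X - Φ t Y‖ < K * Real.exp (-β * (t - t₀)) * ‖X - Y‖ := by
  obtain ⟨m, M, hm, hM, hmf, hbounds⟩ := hF.exists_diagonalBounds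
  let g : ℝ → ℝ := fun ν => diagonalRate F ν / F (fun _ => ν) ν
  have hf0 : ∀ ν, F (fun _ => ν) ν ≠ 0 := fun ν => (hm.trans_le (hmf ν)).ne'
  have hgc : Continuous g := by
    refine Continuous.div ?_ hF.continuous_diagonal_value hf0
    exact (hF.continuous_fderiv.comp (continuous_diagonal N)).clm_apply continuous_const
  have hgp : Function.Periodic g 1 := fun ν => by
    have h1 := hF.periodic_diagonal_value ν
    have h2 := hF.periodic_fderiv (diagonal N ν)
    simp only at h1
    simp only [g, diagonalRate, diagonal_add_one, h1, h2]
  have hg : ∀ ν, g ν * F (fun _ => ν) ν = diagonalRate F ν := fun ν => div_mul_cancel₀ _ (hf0 ν)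
  obtain ⟨γ, hγ, hγg⟩ : ∃ γ > 0, γ = -∫ s in (0 : ℝ)..1, g s := by
    refine ⟨_, ?_, rfl⟩
    have : ∫ s in (0 : ℝ)..1, g s < 0 := by
      simpa only [HypHStar, hF.deriv_eq_diagonalRate] using hFstar
    linarith
  obtain ⟨w, hwp, hw0, hwd, hwg⟩ := exists_periodic_weight hgc hgp hγg
  have hwc : Continuous w := continuous_iff_continuousAt.2 fun ν => (hwd ν).continuousAt
  obtain ⟨w₀, hw₀, hww₀⟩ := exists_pos_le_of_periodic hwc hwp fun s _ => hw0 s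
  obtain ⟨w₁, hww₁'⟩ := exists_norm_le_of_periodic hwc hwp
  have hww₁ : ∀ ν, w ν ≤ w₁ := fun ν => (le_abs_self _).trans (hww₁' ν)
  have hw₁ : 0 < w₁ := (hw0 0).trans_le (hww₁ 0)
  obtain ⟨G, hG⟩ := exists_norm_le_of_periodic (φ := fun ν => g ν + γ)
    (hgc.add continuous_const) fun ν => by simp only [hgp ν]
  have hG0 : 0 ≤ G := (norm_nonneg _).trans (hG 0)
  -- The three bounds serve, in turn, speeds of at least `m / 2`, the inward field on the boundary,
  -- and a contraction error of at most `γ / 2`.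
  let ε := min (m / 4) (min (γ * m / 2 / (G + 1)) (γ / 2 * (m / 2) ^ 2 / (10 * M + 4 * m)))
  have hε : 0 < ε := lt_min (by positivity) (lt_min (by positivity) (by positivity))
  have hεm : ε ≤ m / 4 := min_le_left _ _
  have hεG : (G + 1) * ε ≤ γ * m / 2 := by
    rw [mul_comm, ← le_div_iff₀ (by positivity)]
    exact (min_le_right _ _).trans (min_le_left _ _)
  have hεγ : ε * (10 * M + 4 * m) / (m / 2) ^ 2 ≤ γ / 2 := by
    rw [div_le_iff₀ (by positivity), ← le_div_iff₀ (by positivity)]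
    exact (min_le_right _ _).trans (min_le_right _ _)
  obtain ⟨δ₀, hδ₀, hb₀⟩ := hbounds ε hε
  let δ := min δ₀ (1 / 2)
  have hδ : δ ≤ 1 / 2 := min_le_right _ _
  have hδ0 : 0 < δ := lt_min hδ₀ (by norm_num)
  have h : DiagonalBounds F m M ε δ := hb₀.mono (min_le_left _ _)
  refine ⟨δ / 2, half_pos hδ0, fun D hDm => ?_⟩
  have hD0 : 0 < D := hDm.1
  have hD : 2 * D ≤ δ := by linarith [hDm.2]
  have hNpos : (0 : ℝ) < N := by exact_mod_cast (by omega : 0 < N)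
  have hN1 : (1 : ℝ) ≤ N := by exact_mod_cast (by omega : 1 ≤ N)
  -- Normalized by the upper bound `w₁` of the weight so that the radius never exceeds `D`.
  let Δ : ℝ → ℝ := fun ν => D / w₁ * w ν
  have hDw : 0 < D / w₁ := div_pos hD0 hw₁
  have hΔd : ∀ ν, HasDerivAt Δ ((g ν + γ) * Δ ν) ν := fun ν =>
    ((hwd ν).const_mul (D / w₁)).congr_deriv (by simp only [Δ]; ring)
  have hΔ0 : ∀ ν, 0 < Δ ν := fun ν => mul_pos hDw (hw0 ν)
  have hΔD : ∀ ν, Δ ν ≤ D := fun ν => by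
    have := mul_le_mul_of_nonneg_left (hww₁ ν) hDw.le
    rwa [div_mul_cancel₀ _ hw₁.ne'] at this
  have hΔC : ContDiff ℝ 1 Δ := by
    rw [contDiff_one_iff_deriv]
    refine ⟨fun ν => (hΔd ν).differentiableAt, ?_⟩
    rw [funext fun ν => (hΔd ν).deriv]
    exact (hgc.add continuous_const).mul (continuous_const.mul hwc)
  -- Entrywise bounds on `dH` give a Lipschitz constant `N * r`, whence `ε / N`. The second bound is
  -- the inward margin for the lower bound `D / w₁ * w₀` of the radius.
  let r := min (ε / N) (γ * m / 2 * (D / w₁ * w₀))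
  have hr0 : 0 < r := lt_min (by positivity) (by positivity)
  have hrε : r ≤ ε := (min_le_left _ _).trans (div_le_self hε.le hN1)
  have hrN : N * r ≤ ε := by
    rw [mul_comm, ← le_div_iff₀ hNpos]; exact min_le_left _ _
  have hr : ∀ ν, r ≤ γ * m / 2 * Δ ν := fun ν => (min_le_right _ _).trans
    (mul_le_mul_of_nonneg_left (mul_le_mul_of_nonneg_left (hww₀ ν) hDw.le) (by positivity))
  refine ⟨r, hr0, Δ, ⟨hΔC, fun ν => by simp only [Δ, hwp ν], fun ν => ⟨hΔ0 ν, hΔD ν⟩⟩,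
    fun H hHC hH t₀ => ?_, fun H hHC hH t₀ Φ hΦ => ?_⟩
  · exact isSynchronized_tube h hg hG hγ hεG hεm hδ hΔd hΔ0 hΔC hΔD hD hHC
      (fun y hy i => abs_lt_of_normB_lt hH hy i) hr hrε t₀
  · have hHr : ∀ y ∈ band N, ∀ i, |H y i| < r := fun y hy i =>
      abs_lt_of_normB_lt ((le_max_left _ _).trans_lt hH) hy i
    obtain ⟨k, c, L, κ, C₁, K₀, β, hpc⟩ := exists_phaseContraction h hg hG hγ hεG hεm hδ hΔd hΔ0 hΔC
      hΔD hD hHC hHr hr hrε ⟨0, by omega⟩ hgc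
      (fun ν x hx y hy i => (abs_sub_le_of_normB1_lt hHC hr0.le ((le_max_right _ _).trans_lt hH) hδ
        hx hy i).trans (mul_le_mul_of_nonneg_right hrN (norm_nonneg _)))
      hε.le hεγ hw₀ hww₀ hww₁ hwg
    exact hpc.exists_stable_hypersurfaces hΦ
      ((forward_invariant_tube h hg hG hγ hεG hεm hδ hΔd hΔ0 hΔC hΔD hD hHC hHr hr hrε t₀).2 Φ hΦ)
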